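/- Fix an integer $p\ge 3$. Let $\{J_{i_1,\dots,i_p} : 1\le i_1<\dots<i_p\}$ be a family of independent standard normal random variables defined on a probability space. For $N\ge 1$ and $\sigma\in\{-1,+1\}^N$ set $$X_\sigma=\binom{N}{p}^{-1/2}\sum_{1\le i_1<\dots<i_p\le N}J_{i_1,\dots,i_p}\,\sigma_{i_1}\cdots\sigma_{i_p},\qquad H_N(\sigma)=-\sqrt N\,X_\sigma$$ (with $X_\sigma=0$ if $N<p$), and for $\beta\ge 0$ let $$Z_N(\beta)=2^{-N}\sum_{\sigma\in\{-1,+1\}^N}e^{-\beta H_N(\sigma)},\qquad F_N(\beta)=\frac1N\ln Z_N(\beta).$$ Let $\beta_p\ge 0$ be defined by $$\beta_p^2=\inf_{0<m<1}\bigl(1+m^{-p}\bigr)\phi(m),\qquad \phi(m)=\frac{1-m}{2}\ln(1-m)+\frac{1+m}{2}\ln(1+m).$$ Then for every $\beta$ with $0\le\beta<\beta_p$, $$N^{p/2}\Bigl(F_N(\beta)-\frac{\beta^2}{2}\Bigr)\longrightarrow\mathcal N\Bigl(0,\frac{\beta^4\,p!}{2}\Bigr)\quad\text{in distribution, as } N\to\infty,$$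 where $\mathcal N(0,0)$ denotes the unit mass at $0$. -/

import Mathlib

open MeasureTheory ProbabilityTheory Filter

namespace PSpin

noncomputable section

/-- Spin configurations, `S_N = {-1, +1}^N`; the two units of `ℤ` are `1` and `-1`. -/
abbrev Config (N : ℕ) : Type := Fin N → ℤˣ

/-- `σ_A`, the product of the spins `σ_i` over `i ∈ A`. -/
def spinProd {N : ℕ} (σ : Config N) (A : Finset (Fin N)) : ℝ :=
  ∏ i ∈ A, (((σ i : ℤˣ) : ℤ) : ℝ)

/-- The random field `X_σ` for the couplings `J`. A strictly increasing `p`-tuple of sites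
is identified with the set of its entries, and sites are numbered from `0`. The couplings are
indexed by finite subsets of `ℕ`, so that all system sizes `N` share the same couplings. -/
def field (p N : ℕ) (J : Finset ℕ → ℝ) (σ : Config N) : ℝ :=
  (√(N.choose p : ℝ))⁻¹ *
    ∑ A ∈ Finset.powersetCard p (Finset.univ : Finset (Fin N)),
      J (A.map Fin.valEmbedding) * spinProd σ A

/-- The Hamiltonian `H_N(σ) = -√N X_σ`. -/
def hamiltonian (p N : ℕ) (J : Finset ℕ → ℝ) (σ : Config N) : ℝ :=
  -√(N : ℝ) * field p N J σ

/-- The partition function `Z_N(β)`, normalised by the number `2^N` of configurations. -/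
def partitionFn (p N : ℕ) (β : ℝ) (J : Finset ℕ → ℝ) : ℝ :=
  ((2 : ℝ) ^ N)⁻¹ * ∑ σ : Config N, Real.exp (-β * hamiltonian p N J σ)

/-- (Minus) the free energy `F_N(β) = N⁻¹ log Z_N(β)`. -/
def freeEnergy (p N : ℕ) (β : ℝ) (J : Finset ℕ → ℝ) : ℝ :=
  (1 / (N : ℝ)) * Real.log (partitionFn p N β J)

/-- The function `φ`. -/
def phi (m : ℝ) : ℝ :=
  (1 - m) / 2 * Real.log (1 - m) + (1 + m) / 2 * Real.log (1 + m)

/-- `β_p`, the nonnegative number with `β_p ^ 2 = inf_{0 < m < 1} (1 + m^{-p}) φ(m)`.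
The set is nonempty and `φ ≥ 0` on `(0, 1)`, so this is a genuine nonnegative infimum. -/
def betaCrit (p : ℕ) : ℝ :=
  √(sInf ((fun m : ℝ => (1 + (m ^ p)⁻¹) * phi m) '' Set.Ioo (0 : ℝ) 1))

end

end PSpin

namespace PSpin

noncomputable section

/-! Put `C = N.choose p` and `γ = β√N/√C`, so that the Boltzmann weight is `exp (γ ∑ J_A σ_A)`. The
fluctuations of the free energy come from the σ-independent factor `exp (γ²/2 ∑ J_A²)`. Splitting it
off (`partitionFn_eq`) leaves the average of a weight normalised to mean one, and the deterministic
mean of that weight. The exponent `γ²/2 ∑ J_A²` equals `β²N/2` plus a multiple of the centred sum of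
the `J_A²`. After multiplication by `N^(p/2 - 1)` the centred part obeys the ordinary central limit
theorem, with variance `β⁴ p!/2` in the limit (`tendstoInDistribution_sqSum`,
`scaled_freeEnergy_eq`).

It remains to see that the other two factors are `1 + o(N^(-(p-2)/2))`. For the mean this is a
Taylor expansion. For the averaged weight, `tendstoInMeasure_avg_weight` uses a truncated second
moment. Configurations with energy above `(β+ε)√N√C` carry an exponentially small mean. The second
moment of the rest is an average over one configuration `τ`, the product of two replicas, that sees
the couplings only through the symmetric sum `e_p(τ)`.

For small overlap the pair correlation is about `exp (q e_p - C q²/2)`, with `q` close to `γ²`.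
Since `e_p` has mean zero and second moment `C`, the terms up to second order cancel, and the cubic
remainder `N^(3 - 3p/2)` is `o(N^(2-p))`. For overlap `r` away from zero, truncation improves the
exponent to about `N β² |r|^p/(1+|r|^p)`, while such overlaps have probability about `exp (-N
φ(r))`. The definition of `β_p` says exactly that the entropy wins when `β < β_p`. -/

/-- The total magnetisation `∑ i, τ i`. -/
def totalSpin {N : ℕ} (τ : Config N) : ℝ := ∑ i, (((τ i : ℤˣ) : ℤ) : ℝ)

/-- The elementary symmetric polynomial of degree `k` in the spins. -/
def symSum {N : ℕ} (k : ℕ) (τ : Config N) : ℝ :=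
  ∑ A ∈ Finset.powersetCard k (Finset.univ : Finset (Fin N)), spinProd τ A

/-- The power sum of degree `k` in the spins. -/
def powSum {N : ℕ} (k : ℕ) (τ : Config N) : ℝ := ∑ i, (((τ i : ℤˣ) : ℤ) : ℝ) ^ k

/-! ### Symmetric functions of the spins -/

lemma spin_eq_or (u : ℤˣ) : ((u : ℤ) : ℝ) = 1 ∨ ((u : ℤ) : ℝ) = -1 := by
  rcases Int.units_eq_one_or u with rfl | rfl <;> simp

lemma spin_sq (u : ℤˣ) : ((u : ℤ) : ℝ) ^ 2 = 1 := by
  rcases spin_eq_or u with h | h <;> simp [h]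

lemma abs_spin (u : ℤˣ) : |((u : ℤ) : ℝ)| = 1 := by
  rcases spin_eq_or u with h | h <;> simp [h]

lemma spinProd_mul {N : ℕ} (σ τ : Config N) (A : Finset (Fin N)) :
    spinProd (σ * τ) A = spinProd σ A * spinProd τ A := by
  simp [spinProd, Finset.prod_mul_distrib]

lemma spinProd_sq {N : ℕ} (σ : Config N) (A : Finset (Fin N)) : spinProd σ A ^ 2 = 1 := by
  simp [spinProd, ← Finset.prod_pow, spin_sq]

lemma symSum_zero {N : ℕ} (τ : Config N) : symSum 0 τ = 1 := by
  simp [symSum, spinProd]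

lemma symSum_one_config (N k : ℕ) : symSum k (1 : Config N) = N.choose k := by
  simp [symSum, spinProd]

lemma totalSpin_one (N : ℕ) : totalSpin (1 : Config N) = N := by
  simp [totalSpin]

lemma abs_totalSpin_le {N : ℕ} (τ : Config N) : |totalSpin τ| ≤ N := by
  refine (Finset.abs_sum_le_sum_abs _ _).trans ?_
  simp [abs_spin]

lemma newton {N : ℕ} (k : ℕ) (τ : Config N) :
    (k : ℝ) * symSum k τ = (-1) ^ (k + 1) *
      ∑ a ∈ Finset.HasAntidiagonal.antidiagonal k with a.1 < k, (-1) ^ a.1 * symSum a.1 τ * powSum a.2 τ := by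
  have h := congrArg (MvPolynomial.aeval fun i => (((τ i : ℤˣ) : ℤ) : ℝ))
    (MvPolynomial.mul_esymm_eq_sum (Fin N) ℝ k)
  simpa [MvPolynomial.esymm, MvPolynomial.psum, symSum, powSum, spinProd] using h

lemma abs_powSum_le {N : ℕ} (k : ℕ) (τ : Config N) : |powSum k τ| ≤ N := by
  refine (Finset.abs_sum_le_sum_abs _ _).trans ?_
  simp [abs_spin, abs_pow]

lemma powSum_one {N : ℕ} (τ : Config N) : powSum 1 τ = totalSpin τ := by
  simp [powSum, totalSpin]

lemma abs_powSum_le_pow {N : ℕ} {T : ℝ} (hT : 1 ≤ T) (τ : Config N) (hS : |totalSpin τ| ≤ T)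
    (hN : (N : ℝ) ≤ T ^ 2) {k : ℕ} (hk : 1 ≤ k) : |powSum k τ| ≤ T ^ k := by
  rcases hk.eq_or_lt with rfl | h
  · simpa [powSum_one] using hS
  · exact (abs_powSum_le k τ).trans (hN.trans (pow_le_pow_right₀ hT h))

/-- Newton's identities give a recursion: the first power sum is at most `T` and the higher ones at
most `N ≤ T²`, so each of the at most `k` terms is bounded by `T ^ k`, which pays for the factor `k`
on the left. With `T` of order `√N` this is far better than the trivial bound. -/
lemma abs_symSum_le {N : ℕ} {T : ℝ} (hT : 1 ≤ T) (τ : Config N) (hS : |totalSpin τ| ≤ T)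
    (hN : (N : ℝ) ≤ T ^ 2) (k : ℕ) : |symSum k τ| ≤ T ^ k := by
  induction k using Nat.strong_induction_on with
  | _ k ih =>
    rcases Nat.eq_zero_or_pos k with rfl | hk
    · simp [symSum_zero]
    have hk' : (0 : ℝ) < k := by exact_mod_cast hk
    have h1 : |(k : ℝ) * symSum k τ| ≤ k * T ^ k := by
      rw [newton, abs_mul, abs_pow, abs_neg, abs_one, one_pow, one_mul]
      refine (Finset.abs_sum_le_sum_abs _ _).trans ?_
      have hcard : (Finset.filter (fun a : ℕ × ℕ => a.1 < k) (Finset.HasAntidiagonal.antidiagonal k)).card ≤ k := by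
        calc _ ≤ (Finset.range k).card := Finset.card_le_card_of_injOn Prod.fst
                (fun a ha => by
                  simp only [Finset.coe_filter, Set.mem_ofPred_eq] at ha
                  simpa using ha.2)
                (fun a ha b hb hab => by
                  simp only [Finset.coe_filter, Set.mem_ofPred_eq, Finset.HasAntidiagonal.mem_antidiagonal] at ha hb
                  ext <;> omega)
          _ = k := by simp
      calc _ ≤ ∑ a ∈ Finset.HasAntidiagonal.antidiagonal k with a.1 < k, T ^ k := by
            refine Finset.sum_le_sum fun a ha => ?_
            simp only [Finset.mem_filter, Finset.HasAntidiagonal.mem_antidiagonal] at ha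
            rw [abs_mul, abs_mul, abs_pow, abs_neg, abs_one, one_pow, one_mul, ← ha.1, pow_add]
            gcongr
            · exact ih _ ha.2
            · exact abs_powSum_le_pow hT τ hS hN (by omega)
        _ ≤ k * T ^ k := by
            rw [Finset.sum_const, nsmul_eq_mul]
            gcongr
    rw [abs_mul, abs_of_pos hk'] at h1
    exact le_of_mul_le_mul_left h1 hk'

lemma abs_symSum_le_card_pow {N : ℕ} (τ : Config N) (k : ℕ) : |symSum k τ| ≤ (N : ℝ) ^ k := by
  rcases Nat.eq_zero_or_pos N with rfl | hN
  · rcases k with _ | k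
    · simp [symSum_zero]
    · simp [symSum, Finset.powersetCard_eq_empty.2 (show (∅ : Finset (Fin 0)).card < k + 1 by simp)]
  have h : (1 : ℝ) ≤ N := by exact_mod_cast hN
  exact abs_symSum_le h τ (abs_totalSpin_le τ) (by nlinarith) k

/-- In Newton's identity the term with the first power sum reproduces `S · e_k`; every other term
loses a factor `N`, because a higher power sum is only `O(N)`. The errors add up as `k! + k · k! =
(k+1)!`. -/
lemma abs_factorial_mul_symSum_sub_le {N : ℕ} (τ : Config N) (k : ℕ) :
    |(k.factorial : ℝ) * symSum k τ - totalSpin τ ^ k| ≤ k.factorial * (N : ℝ) ^ (k - 1) := by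
  induction k with
  | zero => simp [symSum_zero]
  | succ k ih =>
    have hn := newton (k + 1) τ
    let g : ℕ ↪ ℕ × ℕ := ⟨fun i => (i, k + 1 - i), fun i j h => congrArg Prod.fst h⟩
    have hg : ∀ i, g i = (i, k + 1 - i) := fun _ => rfl
    have hset : Finset.filter (fun a : ℕ × ℕ => a.1 < k + 1)
        (Finset.HasAntidiagonal.antidiagonal (k + 1)) = (Finset.range (k + 1)).map g := by
      ext ⟨a, b⟩
      simp only [Finset.mem_filter, Finset.HasAntidiagonal.mem_antidiagonal, Finset.mem_map, Finset.mem_range, hg,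
        Prod.mk.injEq]
      constructor
      · rintro ⟨h1, h2⟩
        exact ⟨a, h2, rfl, by omega⟩
      · rintro ⟨i, hi, rfl, rfl⟩
        omega
    rw [hset, Finset.sum_map, Finset.sum_range_succ] at hn
    simp only [hg, Nat.add_sub_cancel_left, powSum_one] at hn
    set R := ∑ i ∈ Finset.range k, (-1 : ℝ) ^ i * symSum i τ * powSum (k + 1 - i) τ with hR
    have hRle : |R| ≤ k * (N : ℝ) ^ k := by
      refine (Finset.abs_sum_le_sum_abs _ _).trans ?_
      calc _ ≤ ∑ i ∈ Finset.range k, (N : ℝ) ^ k := by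
            refine Finset.sum_le_sum fun i hi => ?_
            have hi' := Finset.mem_range.1 hi
            rw [abs_mul, abs_mul, abs_pow, abs_neg, abs_one, one_pow, one_mul]
            rcases Nat.eq_zero_or_pos N with rfl | hN
            · simp [powSum]
            have h1 : (1 : ℝ) ≤ N := by exact_mod_cast hN
            calc _ ≤ (N : ℝ) ^ i * N :=
                  mul_le_mul (abs_symSum_le_card_pow τ i) (abs_powSum_le _ τ) (abs_nonneg _)
                    (by positivity)
              _ = (N : ℝ) ^ (i + 1) := by ring
              _ ≤ _ := pow_le_pow_right₀ h1 hi'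
        _ = _ := by simp
    have hs : ((-1 : ℝ) ^ (k + 1 + 1)) * (-1) ^ k = 1 := by
      rw [← pow_add]; exact Even.neg_one_pow ⟨k + 1, by ring⟩
    have key : ((k + 1).factorial : ℝ) * symSum (k + 1) τ - totalSpin τ ^ (k + 1)
        = totalSpin τ * ((k.factorial : ℝ) * symSum k τ - totalSpin τ ^ k)
          + k.factorial * ((-1) ^ (k + 1 + 1) * R) := by
      have : ((k + 1).factorial : ℝ) * symSum (k + 1) τ
          = k.factorial * (((k + 1 : ℕ) : ℝ) * symSum (k + 1) τ) := by
        rw [Nat.factorial_succ]; push_cast; ring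
      rw [this, hn]
      linear_combination (k.factorial : ℝ) * symSum k τ * totalSpin τ * hs
    rw [key, Nat.add_sub_cancel]
    have h2 : |(k.factorial : ℝ) * ((-1) ^ (k + 1 + 1) * R)| ≤ k.factorial * (k * (N : ℝ) ^ k) := by
      rw [abs_mul, abs_mul, abs_pow, abs_neg, abs_one, one_pow, one_mul, Nat.abs_cast]
      gcongr
    -- Here `k - 1` truncates at `k = 0`, where the inductive bound would be too weak; the
    -- difference then vanishes.
    rcases Nat.eq_zero_or_pos k with rfl | hk
    · simp [symSum_zero, hR]
    have h3 : |totalSpin τ * ((k.factorial : ℝ) * symSum k τ - totalSpin τ ^ k)|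
        ≤ k.factorial * (N : ℝ) ^ k := by
      rw [abs_mul]
      calc _ ≤ (N : ℝ) * (k.factorial * (N : ℝ) ^ (k - 1)) :=
            mul_le_mul (abs_totalSpin_le τ) ih (abs_nonneg _) (by positivity)
        _ = k.factorial * ((N : ℝ) ^ (k - 1) * N) := by ring
        _ = _ := by rw [← pow_succ, Nat.sub_add_cancel hk]
    refine (abs_add_le _ _).trans ((add_le_add h3 h2).trans (le_of_eq ?_))
    rw [Nat.factorial_succ]; push_cast; ring

/-! ### One-dimensional Gaussian integrals -/

/-- Closed form of `∫ exp (a x - b x²)` under the standard normal law, for `b > -1/2`. -/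
lemma integral_exp_linear_sub_sq (a : ℝ) {b : ℝ} (hb : 0 < 1 + 2 * b) :
    ∫ x, Real.exp (a * x - b * x ^ 2) ∂(gaussianReal 0 1)
      = (√(1 + 2 * b))⁻¹ * Real.exp (a ^ 2 / (2 * (1 + 2 * b))) := by
  set c := 1 + 2 * b with hc
  rw [integral_gaussianReal_eq_integral_smul one_ne_zero]
  have hvc : ((c⁻¹.toNNReal : NNReal) : ℝ) = c⁻¹ := Real.coe_toNNReal _ (by positivity)
  have hv : c⁻¹.toNNReal ≠ 0 := (Real.toNNReal_pos.2 (inv_pos.2 hb)).ne'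
  have key : ∀ x : ℝ, gaussianPDFReal 0 1 x • Real.exp (a * x - b * x ^ 2)
      = ((√c)⁻¹ * Real.exp (a ^ 2 / (2 * c))) * gaussianPDFReal (a / c) c⁻¹.toNNReal x := by
    intro x
    simp only [gaussianPDFReal, smul_eq_mul, NNReal.coe_one, hvc]
    have h1 : √(2 * Real.pi * c⁻¹) = √(2 * Real.pi * 1) * (√c)⁻¹ := by
      rw [Real.sqrt_mul (by positivity), Real.sqrt_inv, mul_one]
    have h2 : √c ≠ 0 := (Real.sqrt_pos.2 hb).ne'
    have h3 : √(2 * Real.pi * 1) ≠ 0 := (Real.sqrt_pos.2 (by positivity)).ne'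
    have h4 : Real.exp (-(x - 0) ^ 2 / (2 * 1)) * Real.exp (a * x - b * x ^ 2)
        = Real.exp (a ^ 2 / (2 * c)) * Real.exp (-(x - a / c) ^ 2 / (2 * c⁻¹)) := by
      rw [← Real.exp_add, ← Real.exp_add]
      congr 1
      field_simp
      rw [hc]; ring
    rw [h1, mul_assoc, h4]
    field_simp
  simp_rw [key]
  rw [integral_const_mul, integral_gaussianPDFReal_eq_one _ hv, mul_one]

/-- A non-integrable function has integral `0` by convention, whereas the closed form is positive.
-/
lemma integrable_exp_linear_sub_sq (a : ℝ) {b : ℝ} (hb : 0 < 1 + 2 * b) :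
    Integrable (fun x => Real.exp (a * x - b * x ^ 2)) (gaussianReal 0 1) := by
  by_contra h
  have h1 := integral_exp_linear_sub_sq a hb
  rw [integral_undef h] at h1
  have : 0 < √(1 + 2 * b) := Real.sqrt_pos.2 hb
  have h2 : 0 < (√(1 + 2 * b))⁻¹ * Real.exp (a ^ 2 / (2 * (1 + 2 * b))) := by positivity
  exact h2.ne h1

/-! ### Averages over spins, exponential moments and large deviations -/

/-- The average over all spin configurations. -/
def avg {N : ℕ} (f : Config N → ℝ) : ℝ := ((2 : ℝ) ^ N)⁻¹ * ∑ τ, f τ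

section avg
variable {N : ℕ}

lemma avg_mono {f g : Config N → ℝ} (h : ∀ τ, f τ ≤ g τ) : avg f ≤ avg g :=
  mul_le_mul_of_nonneg_left (Finset.sum_le_sum fun τ _ => h τ) (by positivity)

lemma avg_add (f g : Config N → ℝ) : avg (fun τ => f τ + g τ) = avg f + avg g := by
  simp [avg, Finset.sum_add_distrib, mul_add]

lemma avg_const_mul (c : ℝ) (f : Config N → ℝ) : avg (fun τ => c * f τ) = c * avg f := by
  simp only [avg, ← Finset.mul_sum]; ring

lemma avg_sum {ι : Type*} (s : Finset ι) (f : ι → Config N → ℝ) :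
    avg (fun τ => ∑ i ∈ s, f i τ) = ∑ i ∈ s, avg (f i) := by
  simp only [avg]
  rw [Finset.sum_comm, Finset.mul_sum]

lemma avg_const (c : ℝ) : avg (fun _ : Config N => c) = c := by
  simp [avg]

lemma avg_prod (f : Fin N → ℤˣ → ℝ) :
    avg (fun τ : Config N => ∏ i, f i (τ i)) = ∏ i, (f i 1 + f i (-1)) / 2 := by
  have h := Finset.prod_univ_sum (fun _ : Fin N => (Finset.univ : Finset ℤˣ)) f
  rw [Fintype.piFinset_univ] at h
  have h2 : ∀ i, ∑ u, f i u = f i 1 + f i (-1) := fun i => by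
    rw [UnitsInt.univ, Finset.sum_pair (by decide)]
  simp only [h2] at h
  rw [avg, ← h, Finset.prod_div_distrib]
  simp [div_eq_inv_mul]

lemma avg_comp_mul_left (σ : Config N) (f : Config N → ℝ) : avg (fun τ => f (σ * τ)) = avg f := by
  simp only [avg]
  rw [← Equiv.sum_comp (Equiv.mulLeft σ) f]
  rfl

lemma avg_spinProd_mul_spinProd (A B : Finset (Fin N)) :
    avg (fun τ => spinProd τ A * spinProd τ B) = if A = B then 1 else 0 := by
  split_ifs with h
  · subst h
    simp only [← sq, spinProd_sq, avg_const]
  · have h1 : ∀ τ : Config N, spinProd τ A * spinProd τ B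
        = ∏ i, ((if i ∈ A then ((τ i : ℤ) : ℝ) else 1) * (if i ∈ B then ((τ i : ℤ) : ℝ) else 1)) := by
      intro τ
      rw [Finset.prod_mul_distrib, Finset.prod_ite_mem, Finset.prod_ite_mem]
      simp [spinProd]
    simp only [h1]
    rw [avg_prod fun i u => (if i ∈ A then ((u : ℤ) : ℝ) else 1) * (if i ∈ B then ((u : ℤ) : ℝ) else 1)]
    obtain ⟨i, hi⟩ : ∃ i, ¬ (i ∈ A ↔ i ∈ B) := by
      by_contra hcon
      push Not at hcon
      exact h (Finset.ext hcon)
    refine Finset.prod_eq_zero (Finset.mem_univ i) ?_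
    by_cases hA : i ∈ A <;> by_cases hB : i ∈ B <;> simp_all

lemma avg_symSum {k : ℕ} (hk : k ≠ 0) : avg (fun τ : Config N => symSum k τ) = 0 := by
  simp only [symSum]
  rw [avg_sum]
  refine Finset.sum_eq_zero fun A hA => ?_
  have h := avg_spinProd_mul_spinProd A (∅ : Finset (Fin N))
  have hne : A ≠ ∅ := by
    rintro rfl
    exact hk (by simpa using (Finset.mem_powersetCard.1 hA).2.symm)
  rw [if_neg hne] at h
  simpa [spinProd] using h

lemma avg_symSum_sq (k : ℕ) : avg (fun τ : Config N => symSum k τ ^ 2) = N.choose k := by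
  simp only [symSum, sq, Finset.sum_mul_sum]
  rw [avg_sum]
  simp only [avg_sum, avg_spinProd_mul_spinProd]
  rw [Finset.sum_congr rfl fun A hA => by rw [Finset.sum_ite_eq, if_pos hA]]
  simp

lemma avg_exp_mul_totalSpin_le (t : ℝ) :
    avg (fun τ : Config N => Real.exp (t * totalSpin τ)) ≤ Real.exp (N * (t ^ 2 / 2)) := by
  have h : ∀ τ : Config N, Real.exp (t * totalSpin τ) = ∏ i, Real.exp (t * ((τ i : ℤ) : ℝ)) := by
    intro τ
    rw [totalSpin, Finset.mul_sum, Real.exp_sum]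
  simp only [h]
  rw [avg_prod fun _ u => Real.exp (t * ((u : ℤ) : ℝ))]
  have h2 := pow_le_pow_left₀ (Real.cosh_pos t).le (Real.cosh_le_exp_half_sq t) N
  rw [← Real.exp_nat_mul] at h2
  refine le_trans (le_of_eq ?_) h2
  simp [Real.cosh_eq, div_pow]

/-- Gaussian linearisation: the square in the exponent is written as a Gaussian average of `exp (x
S/√(2N))`, and the sub-Gaussian bound for each `x` leaves `exp (x²/4)`, of mean `√2`. -/
lemma avg_exp_sq_totalSpin_le (hN : N ≠ 0) :
    avg (fun τ : Config N => Real.exp (totalSpin τ ^ 2 / (4 * N))) ≤ 2 := by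
  have hN' : (0 : ℝ) < N := by exact_mod_cast Nat.pos_of_ne_zero hN
  have h1 : ∀ τ : Config N, Real.exp (totalSpin τ ^ 2 / (4 * N))
      = ∫ x, Real.exp ((totalSpin τ / √(2 * N)) * x - 0 * x ^ 2) ∂(gaussianReal 0 1) := by
    intro τ
    rw [integral_exp_linear_sub_sq _ (by norm_num)]
    have : √(2 * (N : ℝ)) ^ 2 = 2 * N := Real.sq_sqrt (by positivity)
    rw [div_pow, this]
    simp
    field_simp
    norm_num
  simp only [h1, avg]
  rw [← integral_finsetSum _ fun τ _ => integrable_exp_linear_sub_sq _ (by norm_num),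
    ← integral_const_mul]
  have hi : Integrable (fun x : ℝ => Real.exp (0 * x - (-1 / 4) * x ^ 2)) (gaussianReal 0 1) :=
    integrable_exp_linear_sub_sq 0 (by norm_num)
  refine (integral_mono (Integrable.const_mul (integrable_finsetSum _ fun τ _ =>
    integrable_exp_linear_sub_sq _ (by norm_num)) _) hi fun x => ?_).trans ?_
  · have h2 := avg_exp_mul_totalSpin_le (N := N) (x / √(2 * N))
    have : √(2 * (N : ℝ)) ^ 2 = 2 * N := Real.sq_sqrt (by positivity)
    rw [div_pow, this] at h2
    have e1 : (N : ℝ) * (x ^ 2 / (2 * N) / 2) = 0 * x - -1 / 4 * x ^ 2 := by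
      field_simp
      ring
    have e2 : ∀ τ : Config N, totalSpin τ / √(2 * N) * x - 0 * x ^ 2
        = x / √(2 * N) * totalSpin τ := fun τ => by ring
    simp only [e2]
    rw [← e1]
    exact h2
  · rw [integral_exp_linear_sub_sq _ (by norm_num)]
    have h3 : (1 / 2 : ℝ) ≤ √(1 + 2 * (-1 / 4)) := Real.le_sqrt_of_sq_le (by norm_num)
    calc _ ≤ (1 / 2 : ℝ)⁻¹ * 1 := by
          gcongr
          simp
      _ = 2 := by norm_num

/-- A change of measure: `exp (N φ(m))`, at the actual magnetisation `m`, is the density of the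
product law with mean `m` relative to the uniform law. -/
lemma exp_mul_phi (hN : N ≠ 0) (τ : Config N) :
    Real.exp (N * phi (totalSpin τ / N)) = ∏ i, (1 + totalSpin τ / N * ((τ i : ℤ) : ℝ)) := by
  have hN' : (0 : ℝ) < N := by exact_mod_cast Nat.pos_of_ne_zero hN
  set m := totalSpin τ / N with hm
  have hS : totalSpin τ = N * m := by rw [hm]; field_simp
  have hm1 : |m| ≤ 1 := by
    rw [hm, abs_div, Nat.abs_cast, div_le_one hN']
    exact abs_totalSpin_le τ
  have hm2 := abs_le.1 hm1
  have hpos : ∀ i, 0 < 1 + m * ((τ i : ℤ) : ℝ) := by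
    intro i
    rcases hm1.lt_or_eq with h | h
    · have := abs_lt.1 h
      rcases spin_eq_or (τ i) with h' | h' <;> rw [h'] <;> linarith
    -- At `m = ±1` all spins equal `m`, so no factor vanishes and the convention `log 0 = 0` is
    -- harmless.
    · have hsq : m ^ 2 = 1 := by rw [← sq_abs, h, one_pow]
      have hsum : ∑ j, (1 - m * ((τ j : ℤ) : ℝ)) = 0 := by
        rw [Finset.sum_sub_distrib, ← Finset.mul_sum]
        have : ∑ j, ((τ j : ℤ) : ℝ) = N * m := hS
        rw [this]
        simp
        linear_combination (-(N : ℝ)) * hsq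
      have hz := (Finset.sum_eq_zero_iff_of_nonneg (fun j _ => by
        rcases spin_eq_or (τ j) with h' | h' <;> rw [h'] <;> linarith)).1 hsum i (Finset.mem_univ i)
      linarith
  rw [← Real.exp_log (Finset.prod_pos fun i _ => hpos i), Real.log_prod fun i _ => (hpos i).ne']
  congr 1
  have hlog : ∀ i, Real.log (1 + m * ((τ i : ℤ) : ℝ))
      = (Real.log (1 + m) + Real.log (1 - m)) / 2
        + (Real.log (1 + m) - Real.log (1 - m)) / 2 * ((τ i : ℤ) : ℝ) := by
    intro i
    rcases spin_eq_or (τ i) with h' | h' <;> rw [h']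
    · rw [mul_one]; ring
    · rw [show 1 + m * -1 = 1 - m by ring]; ring
  simp only [hlog]
  rw [Finset.sum_add_distrib, ← Finset.mul_sum]
  have : ∑ j, ((τ j : ℤ) : ℝ) = N * m := hS
  rw [this, phi]
  simp
  ring

/-- The random `m` is replaced by a sum over all `2N + 1` candidate values; for each fixed value the
product is nonnegative and averages to one. -/
lemma avg_exp_mul_phi_le (hN : N ≠ 0) :
    avg (fun τ : Config N => Real.exp (N * phi (totalSpin τ / N))) ≤ 2 * N + 1 := by
  have hN' : (0 : ℝ) < N := by exact_mod_cast Nat.pos_of_ne_zero hN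
  have h1 : ∀ τ : Config N, Real.exp (N * phi (totalSpin τ / N))
      ≤ ∑ s ∈ Finset.Icc (-(N : ℤ)) N, ∏ i, (1 + (s : ℝ) / N * ((τ i : ℤ) : ℝ)) := by
    intro τ
    have hS : totalSpin τ = ((∑ i, (τ i : ℤ) : ℤ) : ℝ) := by simp [totalSpin]
    rw [exp_mul_phi hN]
    have hle := abs_totalSpin_le τ
    rw [hS] at hle ⊢
    have hle' : |∑ i, (τ i : ℤ)| ≤ (N : ℤ) := by exact_mod_cast hle
    refine Finset.single_le_sum (f := fun s : ℤ => ∏ i, (1 + (s : ℝ) / N * ((τ i : ℤ) : ℝ)))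
      (fun s hs => Finset.prod_nonneg fun i _ => ?_) (Finset.mem_Icc.2 (abs_le.1 hle'))
    have hs' := Finset.mem_Icc.1 hs
    have ha : -(N : ℝ) ≤ s := by exact_mod_cast hs'.1
    have hb : (s : ℝ) ≤ N := by exact_mod_cast hs'.2
    have ha' : -1 ≤ (s : ℝ) / N := by rw [le_div_iff₀ hN']; linarith
    have hb' : (s : ℝ) / N ≤ 1 := by rw [div_le_iff₀ hN']; linarith
    rcases spin_eq_or (τ i) with h' | h' <;> rw [h'] <;> linarith
  refine (avg_mono h1).trans ?_
  rw [avg_sum]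
  have h2 : ∀ s : ℤ, avg (fun τ : Config N => ∏ i, (1 + (s : ℝ) / N * ((τ i : ℤ) : ℝ))) = 1 := by
    intro s
    rw [avg_prod fun _ u => 1 + (s : ℝ) / N * ((u : ℤ) : ℝ)]
    refine Finset.prod_eq_one fun i _ => ?_
    simp
    ring
  simp only [h2]
  simp only [Finset.sum_const, Int.card_Icc, nsmul_eq_mul, mul_one]
  have : ((N : ℤ) + 1 - -(N : ℤ)).toNat = 2 * N + 1 := by omega
  rw [this]
  push_cast
  exact le_rfl

end avg

/-! ### The rate function and the critical threshold -/

lemma phi_neg (m : ℝ) : phi (-m) = phi m := by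
  simp only [phi, sub_neg_eq_add]
  rw [← sub_eq_add_neg]
  ring

lemma phi_abs (m : ℝ) : phi |m| = phi m := by
  rcases abs_choice m with h | h <;> rw [h]
  exact phi_neg m

lemma continuous_phi : Continuous phi := by
  have h1 : Continuous fun m : ℝ => (1 - m) * Real.log (1 - m) :=
    Real.continuous_mul_log.comp (by fun_prop)
  have h2 : Continuous fun m : ℝ => (1 + m) * Real.log (1 + m) :=
    Real.continuous_mul_log.comp (by fun_prop)
  have : phi = fun m : ℝ => (1 / 2) * ((1 - m) * Real.log (1 - m) + (1 + m) * Real.log (1 + m)) := by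
    ext m; rw [phi]; ring
  rw [this]
  fun_prop

lemma phi_nonneg {m : ℝ} (h0 : 0 ≤ m) (h1 : m < 1) : 0 ≤ phi m := by
  have ha := Real.one_sub_inv_le_log_of_pos (show 0 < 1 - m by linarith)
  have hb := Real.one_sub_inv_le_log_of_pos (show 0 < 1 + m by linarith)
  have ha' := mul_le_mul_of_nonneg_left ha (show 0 ≤ (1 - m) / 2 by linarith)
  have hb' := mul_le_mul_of_nonneg_left hb (show 0 ≤ (1 + m) / 2 by linarith)
  have e1 : (1 - m) / 2 * (1 - (1 - m)⁻¹) = -m / 2 := by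
    have : 1 - m ≠ 0 := by linarith
    field_simp; ring
  have e2 : (1 + m) / 2 * (1 - (1 + m)⁻¹) = m / 2 := by
    have : 1 + m ≠ 0 := by linarith
    field_simp; ring
  rw [phi]
  linarith

/-- The defining infimum, cleared of `m^{-p}`. Continuity adds the endpoint `m = 1`, which is needed
because the overlap of two replicas can be `±1`. -/
lemma betaCrit_sq_mul_le_phi (p : ℕ) {m : ℝ} (h0 : 0 < m) (h1 : m ≤ 1) :
    betaCrit p ^ 2 * m ^ p ≤ (1 + m ^ p) * phi m := by
  have hnn : ∀ x ∈ (fun m : ℝ => (1 + (m ^ p)⁻¹) * phi m) '' Set.Ioo (0 : ℝ) 1, 0 ≤ x := by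
    rintro _ ⟨x, hx, rfl⟩
    have := phi_nonneg hx.1.le hx.2
    have := hx.1
    simp only
    positivity
  have hmain : ∀ x ∈ Set.Ioo (0 : ℝ) 1, betaCrit p ^ 2 * x ^ p ≤ (1 + x ^ p) * phi x := by
    intro x hx
    rw [betaCrit, Real.sq_sqrt (Real.sInf_nonneg hnn)]
    have h := csInf_le ⟨0, hnn⟩ (Set.mem_image_of_mem _ hx)
    have hxp : 0 < x ^ p := pow_pos hx.1 p
    calc _ ≤ ((1 + (x ^ p)⁻¹) * phi x) * x ^ p := by gcongr
      _ = _ := by field_simp; ring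
  have hcl : m ∈ closure (Set.Ioo (0 : ℝ) 1) := by
    rw [closure_Ioo (by norm_num)]
    exact ⟨h0.le, h1⟩
  exact le_on_closure hmain (by fun_prop)
    (Continuous.continuousOn ((by fun_prop : Continuous fun x : ℝ => 1 + x ^ p).mul continuous_phi)) hcl

/-! ### Gaussian weights and their truncated moments -/

/-- The couplings `g A`, for `A` of size `p` in `Fin N`, are independent standard normal. -/
structure IsCoupling {Ω : Type*} [MeasurableSpace Ω] (P : Measure Ω) (p N : ℕ)
    (g : Finset (Fin N) → Ω → ℝ) : Prop where
  law : ∀ A ∈ Finset.powersetCard p (Finset.univ : Finset (Fin N)),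
    HasLaw (g A) (gaussianReal 0 1) P
  indep : iIndepFun (fun A : Finset.powersetCard p (Finset.univ : Finset (Fin N)) => g A) P

/-- The unnormalised Hamiltonian `∑ A, J_A σ_A`. -/
def energy {N : ℕ} (p : ℕ) (x : Finset (Fin N) → ℝ) (σ : Config N) : ℝ :=
  ∑ A ∈ Finset.powersetCard p (Finset.univ : Finset (Fin N)), x A * spinProd σ A

/-- The sum of the squares of the couplings. -/
def sqSum {N : ℕ} (p : ℕ) (x : Finset (Fin N) → ℝ) : ℝ :=
  ∑ A ∈ Finset.powersetCard p (Finset.univ : Finset (Fin N)), x A ^ 2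

/-- The mean of `exp (γ ∑ J_A σ_A - γ² / 2 ∑ J_A²)`. -/
def meanWeight (C : ℕ) (γ : ℝ) : ℝ :=
  (√(1 + γ ^ 2))⁻¹ ^ C * Real.exp (γ ^ 2 * C / (2 * (1 + γ ^ 2)))

lemma meanWeight_pos (C : ℕ) (γ : ℝ) : 0 < meanWeight C γ := by
  rw [meanWeight]; positivity

/-- The Boltzmann weight of `σ`, divided by its Gaussian prefactor and its mean. -/
def weight {N : ℕ} (p : ℕ) (γ : ℝ) (x : Finset (Fin N) → ℝ) (σ : Config N) : ℝ :=
  Real.exp (γ * energy p x σ - γ ^ 2 / 2 * sqSum p x) / meanWeight (N.choose p) γ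

/-- The part of the weight on low energy sum. -/
def lowWeight {N : ℕ} (p : ℕ) (γ L : ℝ) (x : Finset (Fin N) → ℝ) (σ : Config N) : ℝ :=
  if energy p x σ ≤ L then weight p γ x σ else 0

/-- The part of the weight on high energy sum. -/
def highWeight {N : ℕ} (p : ℕ) (γ L : ℝ) (x : Finset (Fin N) → ℝ) (σ : Config N) : ℝ :=
  if energy p x σ ≤ L then 0 else weight p γ x σ

section
variable {Ω : Type*} [MeasurableSpace Ω] {P : Measure Ω}
  {p N : ℕ} {g : Finset (Fin N) → Ω → ℝ}

lemma weight_pos (γ : ℝ) (x : Finset (Fin N) → ℝ) (σ : Config N) : 0 < weight p γ x σ :=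
  div_pos (Real.exp_pos _) (meanWeight_pos _ _)

lemma lowWeight_nonneg (γ L : ℝ) (x : Finset (Fin N) → ℝ) (σ : Config N) :
    0 ≤ lowWeight p γ L x σ := by
  unfold lowWeight; split_ifs
  exacts [(weight_pos _ _ _).le, le_rfl]

lemma highWeight_nonneg (γ L : ℝ) (x : Finset (Fin N) → ℝ) (σ : Config N) :
    0 ≤ highWeight p γ L x σ := by
  unfold highWeight; split_ifs
  exacts [le_rfl, (weight_pos _ _ _).le]

lemma low_add_high (γ L : ℝ) (x : Finset (Fin N) → ℝ) (σ : Config N) :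
    lowWeight p γ L x σ + highWeight p γ L x σ = weight p γ x σ := by
  unfold lowWeight highWeight; split_ifs <;> simp

lemma IsCoupling.integral_exp (hg : IsCoupling P p N g) (a : Finset (Fin N) → ℝ) {b : ℝ}
    (hb : 0 < 1 + 2 * b) :
    ∫ ω, Real.exp (∑ A ∈ Finset.powersetCard p (Finset.univ : Finset (Fin N)), g A ω * a A
        - b * sqSum p (fun A => g A ω)) ∂P
      = (√(1 + 2 * b))⁻¹ ^ (N.choose p) * Real.exp ((∑ A ∈ Finset.powersetCard p
        (Finset.univ : Finset (Fin N)), a A ^ 2) / (2 * (1 + 2 * b))) := by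
  have h1 : ∀ ω, Real.exp (∑ A ∈ Finset.powersetCard p (Finset.univ : Finset (Fin N)), g A ω * a A
        - b * sqSum p (fun A => g A ω))
      = ∏ A : Finset.powersetCard p (Finset.univ : Finset (Fin N)),
        Real.exp (a A * g A ω - b * g A ω ^ 2) := by
    intro ω
    rw [Finset.prod_coe_sort _ fun A => Real.exp (a A * g A ω - b * g A ω ^ 2), ← Real.exp_sum,
      Finset.sum_sub_distrib, sqSum, Finset.mul_sum]
    simp only [mul_comm]
  simp only [h1]
  rw [hg.indep.integral_fun_prod_comp (f := fun (A : Finset.powersetCard p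
      (Finset.univ : Finset (Fin N))) x => Real.exp (a A * x - b * x ^ 2))
    (fun A => (hg.law A.1 A.2).aemeasurable) (fun A => by fun_prop)]
  have h2 : ∀ A : Finset.powersetCard p (Finset.univ : Finset (Fin N)),
      ∫ ω, Real.exp (a A * g A ω - b * g A ω ^ 2) ∂P
        = (√(1 + 2 * b))⁻¹ * Real.exp (a A ^ 2 / (2 * (1 + 2 * b))) := by
    intro A
    rw [← integral_exp_linear_sub_sq _ hb]
    exact (hg.law A A.2).integral_comp (f := fun x => Real.exp (a A * x - b * x ^ 2))
      (by fun_prop)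
  simp only [h2]
  rw [Finset.prod_mul_distrib, ← Real.exp_sum,
    Finset.sum_coe_sort _ fun A => a A ^ 2 / (2 * (1 + 2 * b)), ← Finset.sum_div]
  simp

lemma IsCoupling.integrable_exp (hg : IsCoupling P p N g) (a : Finset (Fin N) → ℝ) {b : ℝ}
    (hb : 0 < 1 + 2 * b) :
    Integrable (fun ω => Real.exp (∑ A ∈ Finset.powersetCard p (Finset.univ : Finset (Fin N)),
      g A ω * a A - b * sqSum p (fun A => g A ω))) P := by
  by_contra h
  have h1 := hg.integral_exp a hb
  rw [integral_undef h] at h1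
  have : 0 < √(1 + 2 * b) := Real.sqrt_pos.2 hb
  exact (by positivity : 0 < (√(1 + 2 * b))⁻¹ ^ (N.choose p) * Real.exp ((∑ A ∈ Finset.powersetCard p
        (Finset.univ : Finset (Fin N)), a A ^ 2) / (2 * (1 + 2 * b)))).ne h1

lemma IsCoupling.aemeasurable_energy (hg : IsCoupling P p N g) (σ : Config N) :
    AEMeasurable (fun ω => energy p (fun A => g A ω) σ) P :=
  Finset.aemeasurable_fun_sum _ fun A hA => (hg.law A hA).aemeasurable.mul_const _

lemma IsCoupling.aemeasurable_sqSum (hg : IsCoupling P p N g) :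
    AEMeasurable (fun ω => sqSum p (fun A => g A ω)) P :=
  Finset.aemeasurable_fun_sum _ fun A hA => (hg.law A hA).aemeasurable.pow_const _

lemma IsCoupling.aemeasurable_weight (hg : IsCoupling P p N g) (γ : ℝ) (σ : Config N) :
    AEMeasurable (fun ω => weight p γ (fun A => g A ω) σ) P := by
  have := hg.aemeasurable_energy σ
  have := hg.aemeasurable_sqSum
  unfold weight
  fun_prop

lemma IsCoupling.aemeasurable_lowWeight (hg : IsCoupling P p N g) (γ L : ℝ) (σ : Config N) :
    AEMeasurable (fun ω => lowWeight p γ L (fun A => g A ω) σ) P := by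
  have h1 := hg.aemeasurable_energy σ
  have h2 := hg.aemeasurable_sqSum
  have hm : Measurable fun z : ℝ × ℝ => if z.1 ≤ L then
      Real.exp (γ * z.1 - γ ^ 2 / 2 * z.2) / meanWeight (N.choose p) γ else 0 :=
    Measurable.ite (measurableSet_le measurable_fst measurable_const) (by fun_prop)
      measurable_const
  exact hm.comp_aemeasurable (h1.prodMk h2)

lemma IsCoupling.aemeasurable_highWeight (hg : IsCoupling P p N g) (γ L : ℝ) (σ : Config N) :
    AEMeasurable (fun ω => highWeight p γ L (fun A => g A ω) σ) P := by
  have h := (hg.aemeasurable_weight γ σ).sub (hg.aemeasurable_lowWeight γ L σ)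
  refine h.congr (Eventually.of_forall fun ω => ?_)
  simp [← low_add_high γ L (fun A => g A ω) σ]

lemma sum_mul_spinProd_sq (a : ℝ) (σ : Config N) :
    ∑ A ∈ Finset.powersetCard p (Finset.univ : Finset (Fin N)), (a * spinProd σ A) ^ 2
      = a ^ 2 * N.choose p := by
  simp [mul_pow, spinProd_sq, mul_comm]

/-- The variance of the summed energies of two replicas depends on them only through `σ * τ`; this
reduces the second moment to an average over one configuration. -/
lemma sum_mul_spinProd_add_sq (a : ℝ) (σ τ : Config N) :
    ∑ A ∈ Finset.powersetCard p (Finset.univ : Finset (Fin N)),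
      (a * (spinProd σ A + spinProd τ A)) ^ 2 = 2 * a ^ 2 * (N.choose p + symSum p (σ * τ)) := by
  have : ∀ A : Finset (Fin N), (a * (spinProd σ A + spinProd τ A)) ^ 2
      = 2 * a ^ 2 * (1 + spinProd (σ * τ) A) := by
    intro A
    rw [spinProd_mul]
    linear_combination a ^ 2 * (spinProd_sq σ A) + a ^ 2 * (spinProd_sq τ A)
  simp only [this]
  rw [← Finset.mul_sum, Finset.sum_add_distrib]
  simp [symSum]

lemma IsCoupling.integral_exp_energy (hg : IsCoupling P p N g) (a : ℝ) {b : ℝ}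
    (hb : 0 < 1 + 2 * b) (σ : Config N) :
    ∫ ω, Real.exp (a * energy p (fun A => g A ω) σ - b * sqSum p (fun A => g A ω)) ∂P
      = (√(1 + 2 * b))⁻¹ ^ (N.choose p) * Real.exp (a ^ 2 * N.choose p / (2 * (1 + 2 * b))) := by
  rw [← sum_mul_spinProd_sq a σ, ← hg.integral_exp _ hb]
  simp only [energy, Finset.mul_sum, mul_left_comm]

lemma IsCoupling.integrable_exp_energy (hg : IsCoupling P p N g) (a : ℝ) {b : ℝ}
    (hb : 0 < 1 + 2 * b) (σ : Config N) :
    Integrable (fun ω => Real.exp (a * energy p (fun A => g A ω) σ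
      - b * sqSum p (fun A => g A ω))) P := by
  convert! hg.integrable_exp (fun A => a * spinProd σ A) hb using 4
  simp only [energy, Finset.mul_sum, mul_left_comm]

lemma IsCoupling.integral_exp_energy_add (hg : IsCoupling P p N g) (a : ℝ) {b : ℝ}
    (hb : 0 < 1 + 2 * b) (σ τ : Config N) :
    ∫ ω, Real.exp (a * (energy p (fun A => g A ω) σ + energy p (fun A => g A ω) τ)
        - b * sqSum p (fun A => g A ω)) ∂P
      = (√(1 + 2 * b))⁻¹ ^ (N.choose p)
        * Real.exp (a ^ 2 * (N.choose p + symSum p (σ * τ)) / (1 + 2 * b)) := by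
  rw [show a ^ 2 * (N.choose p + symSum p (σ * τ)) / (1 + 2 * b)
    = 2 * a ^ 2 * (N.choose p + symSum p (σ * τ)) / (2 * (1 + 2 * b)) by field_simp,
    ← sum_mul_spinProd_add_sq a σ τ, ← hg.integral_exp _ hb]
  simp only [energy, ← Finset.sum_add_distrib, Finset.mul_sum, mul_left_comm, ← mul_add]

lemma IsCoupling.integrable_exp_energy_add (hg : IsCoupling P p N g) (a : ℝ) {b : ℝ}
    (hb : 0 < 1 + 2 * b) (σ τ : Config N) :
    Integrable (fun ω => Real.exp (a * (energy p (fun A => g A ω) σ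
      + energy p (fun A => g A ω) τ) - b * sqSum p (fun A => g A ω))) P := by
  convert! hg.integrable_exp (fun A => a * (spinProd σ A + spinProd τ A)) hb using 4
  simp only [energy, ← Finset.sum_add_distrib, Finset.mul_sum, mul_left_comm, ← mul_add]

lemma IsCoupling.integrable_weight (hg : IsCoupling P p N g) (γ : ℝ) (σ : Config N) :
    Integrable (fun ω => weight p γ (fun A => g A ω) σ) P :=
  (hg.integrable_exp_energy γ (b := γ ^ 2 / 2) (by positivity) σ).div_const _

lemma IsCoupling.integral_weight (hg : IsCoupling P p N g) (γ : ℝ) (σ : Config N) :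
    ∫ ω, weight p γ (fun A => g A ω) σ ∂P = 1 := by
  unfold weight
  rw [integral_div, hg.integral_exp_energy γ (b := γ ^ 2 / 2) (by positivity) σ,
    div_eq_one_iff_eq (meanWeight_pos _ _).ne', meanWeight]
  rw [show 2 * (γ ^ 2 / 2) = γ ^ 2 by ring]

lemma IsCoupling.integrable_lowWeight (hg : IsCoupling P p N g) (γ L : ℝ) (σ : Config N) :
    Integrable (fun ω => lowWeight p γ L (fun A => g A ω) σ) P :=
  (hg.integrable_weight γ σ).mono' (hg.aemeasurable_lowWeight γ L σ).aestronglyMeasurable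
    (Eventually.of_forall fun ω => by
      rw [Real.norm_of_nonneg (lowWeight_nonneg _ _ _ _), ← low_add_high γ L (fun A => g A ω) σ]
      linarith [highWeight_nonneg (p := p) γ L (fun A => g A ω) σ])

lemma IsCoupling.integrable_highWeight (hg : IsCoupling P p N g) (γ L : ℝ) (σ : Config N) :
    Integrable (fun ω => highWeight p γ L (fun A => g A ω) σ) P :=
  (hg.integrable_weight γ σ).mono' (hg.aemeasurable_highWeight γ L σ).aestronglyMeasurable
    (Eventually.of_forall fun ω => by
      rw [Real.norm_of_nonneg (highWeight_nonneg _ _ _ _), ← low_add_high γ L (fun A => g A ω) σ]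
      linarith [lowWeight_nonneg (p := p) γ L (fun A => g A ω) σ])

/-- Exponential Chebyshev inequality: the indicator of energy above `L` is at most `exp (θ (energy -
L))`, which shifts `γ` to `γ + θ`. -/
lemma IsCoupling.integral_highWeight_le (hg : IsCoupling P p N g) {γ L θ : ℝ} (hθ : 0 ≤ θ)
    (hγ : 0 ≤ γ) (σ : Config N) :
    ∫ ω, highWeight p γ L (fun A => g A ω) σ ∂P
      ≤ Real.exp (N.choose p * (2 * γ * θ + θ ^ 2) / 2 - θ * L) := by
  have hb : 0 < 1 + 2 * (γ ^ 2 / 2) := by positivity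
  set M := meanWeight (N.choose p) γ with hM
  have hMpos : 0 < M := meanWeight_pos _ _
  have hpt : ∀ ω, highWeight p γ L (fun A => g A ω) σ
      ≤ (Real.exp (-(θ * L)) / M) * Real.exp ((γ + θ) * energy p (fun A => g A ω) σ
        - γ ^ 2 / 2 * sqSum p (fun A => g A ω)) := by
    intro ω
    unfold highWeight
    split_ifs with h
    · positivity
    · rw [weight, ← hM, div_mul_eq_mul_div _ M, ← Real.exp_add]
      gcongr
      push Not at h
      nlinarith [mul_le_mul_of_nonneg_left h.le hθ]
  refine (integral_mono (hg.integrable_highWeight γ L σ)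
    ((hg.integrable_exp_energy (γ + θ) hb σ).const_mul _) hpt).trans ?_
  rw [integral_const_mul, hg.integral_exp_energy _ hb, hM, meanWeight,
    show 2 * (γ ^ 2 / 2) = γ ^ 2 by ring, div_mul_eq_mul_div, div_le_iff₀ (by positivity)]
  rw [mul_left_comm, mul_left_comm (Real.exp _), ← Real.exp_add, ← Real.exp_add]
  refine mul_le_mul_of_nonneg_left (Real.exp_le_exp.2 ?_) (by positivity)
  have h1 : (γ + θ) ^ 2 * (N.choose p : ℝ) / (2 * (1 + γ ^ 2))
      = (N.choose p * (2 * γ * θ + θ ^ 2)) / 2 / (1 + γ ^ 2)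
        + γ ^ 2 * N.choose p / (2 * (1 + γ ^ 2)) := by
    field_simp; ring
  have h2 : (N.choose p * (2 * γ * θ + θ ^ 2)) / 2 / (1 + γ ^ 2)
      ≤ (N.choose p * (2 * γ * θ + θ ^ 2)) / 2 :=
    div_le_self (by positivity) (by nlinarith [sq_nonneg γ])
  linarith

/-- The bound of the truncated pair correlation with tilt `l` and overlap sum `e`. -/
def pairBound (C : ℕ) (γ L l e : ℝ) : ℝ :=
  Real.exp (2 * l * L) * ((√(1 + 2 * γ ^ 2))⁻¹ ^ C
    * Real.exp ((γ - l) ^ 2 * (C + e) / (1 + 2 * γ ^ 2))) / meanWeight C γ ^ 2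

/-- On the truncation event each replica may be charged `exp (l (L - energy)) ≥ 1`, which lowers `γ`
to `γ - l`. -/
lemma lowWeight_mul_le {γ L l : ℝ} (hl : 0 ≤ l) (x : Finset (Fin N) → ℝ) (σ τ : Config N) :
    lowWeight p γ L x σ * lowWeight p γ L x τ
      ≤ (Real.exp (2 * l * L) / meanWeight (N.choose p) γ ^ 2)
        * Real.exp ((γ - l) * (energy p x σ + energy p x τ) - γ ^ 2 * sqSum p x) := by
  have hMpos : 0 < meanWeight (N.choose p) γ := meanWeight_pos _ _
  unfold lowWeight
  split_ifs with h h'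
  · rw [weight, weight, div_mul_div_comm, ← sq,
      div_mul_eq_mul_div _ (meanWeight (N.choose p) γ ^ 2), ← Real.exp_add, ← Real.exp_add]
    refine div_le_div_of_nonneg_right (Real.exp_le_exp.2 ?_) (by positivity)
    nlinarith [mul_le_mul_of_nonneg_left h hl, mul_le_mul_of_nonneg_left h' hl]
  all_goals simp only [mul_zero, zero_mul]; positivity

lemma IsCoupling.integrable_lowWeight_mul (hg : IsCoupling P p N g) (γ L : ℝ) (σ τ : Config N) :
    Integrable (fun ω => lowWeight p γ L (fun A => g A ω) σ * lowWeight p γ L (fun A => g A ω) τ)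
      P := by
  have hb : 0 < 1 + 2 * γ ^ 2 := by positivity
  -- The untilted bound, `l = 0`, already dominates the product.
  refine ((hg.integrable_exp_energy_add (γ - 0) hb σ τ).const_mul
      (Real.exp (2 * 0 * L) / meanWeight (N.choose p) γ ^ 2)).mono'
    ((hg.aemeasurable_lowWeight γ L σ).mul
      (hg.aemeasurable_lowWeight γ L τ)).aestronglyMeasurable
    (Eventually.of_forall fun ω => ?_)
  rw [Real.norm_of_nonneg (mul_nonneg (lowWeight_nonneg _ _ _ _) (lowWeight_nonneg _ _ _ _))]
  exact lowWeight_mul_le le_rfl _ σ τ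

lemma IsCoupling.integral_lowWeight_mul_le (hg : IsCoupling P p N g) {γ L l : ℝ} (hl : 0 ≤ l)
    (σ τ : Config N) :
    ∫ ω, lowWeight p γ L (fun A => g A ω) σ * lowWeight p γ L (fun A => g A ω) τ ∂P
      ≤ pairBound (N.choose p) γ L l (symSum p (σ * τ)) := by
  have hb : 0 < 1 + 2 * γ ^ 2 := by positivity
  refine (integral_mono (hg.integrable_lowWeight_mul γ L σ τ)
    ((hg.integrable_exp_energy_add (γ - l) hb σ τ).const_mul _)
    fun ω => lowWeight_mul_le hl _ σ τ).trans ?_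
  rw [integral_const_mul, hg.integral_exp_energy_add _ hb, pairBound, div_mul_eq_mul_div]

lemma IsCoupling.integrable_avg_lowWeight_sq (hg : IsCoupling P p N g) (γ L : ℝ) :
    Integrable (fun ω => avg (fun σ => lowWeight p γ L (fun A => g A ω) σ) ^ 2) P := by
  simp only [avg, mul_pow, sq (∑ _, _), Finset.sum_mul_sum]
  exact (integrable_finsetSum _ fun σ _ => integrable_finsetSum _ fun τ _ =>
    hg.integrable_lowWeight_mul γ L σ τ).const_mul _

lemma integral_avg {f : Config N → Ω → ℝ} (hf : ∀ σ, Integrable (f σ) P) :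
    ∫ ω, avg (fun σ => f σ ω) ∂P = avg (fun σ => ∫ ω, f σ ω ∂P) := by
  simp only [avg]
  rw [integral_const_mul, integral_finsetSum _ fun σ _ => hf σ]

lemma integrable_avg {f : Config N → Ω → ℝ} (hf : ∀ σ, Integrable (f σ) P) :
    Integrable (fun ω => avg (fun σ => f σ ω)) P :=
  (integrable_finsetSum _ fun σ _ => hf σ).const_mul _

/-- The tilt is introduced separately for each pair of replicas, so it may depend on their product;
translation by `σ` then makes the inner average independent of `σ`. -/
lemma IsCoupling.integral_avg_lowWeight_sq_le (hg : IsCoupling P p N g) {γ L : ℝ}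
    {l : Config N → ℝ} (hl : ∀ τ, 0 ≤ l τ) :
    ∫ ω, avg (fun σ => lowWeight p γ L (fun A => g A ω) σ) ^ 2 ∂P
      ≤ avg (fun τ => pairBound (N.choose p) γ L (l τ) (symSum p τ)) := by
  have h1 : ∀ ω, avg (fun σ => lowWeight p γ L (fun A => g A ω) σ) ^ 2
      = avg (fun σ => avg fun τ : Config N =>
        lowWeight p γ L (fun A => g A ω) σ * lowWeight p γ L (fun A => g A ω) τ) := by
    intro ω
    simp only [avg_const_mul]
    rw [sq, ← avg_const_mul]
    simp only [mul_comm]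
  simp only [h1]
  rw [integral_avg fun σ => integrable_avg fun τ => hg.integrable_lowWeight_mul γ L σ τ]
  calc _ ≤ avg (fun σ : Config N =>
          avg fun τ => pairBound (N.choose p) γ L (l τ) (symSum p τ)) := by
        refine avg_mono fun σ => ?_
        rw [integral_avg fun τ => hg.integrable_lowWeight_mul γ L σ τ,
          ← avg_comp_mul_left σ fun τ => pairBound (N.choose p) γ L (l τ) (symSum p τ)]
        exact avg_mono fun τ => hg.integral_lowWeight_mul_le (hl _) σ τ
    _ = _ := avg_const _

end

/-! ### Expansion of the pair correlation -/

lemma log_one_add_le {q : ℝ} (h0 : 0 ≤ q) (h1 : q ≤ 1 / 2) :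
    Real.log (1 + q) ≤ q - q ^ 2 / 2 + 2 * q ^ 3 := by
  have h := Real.abs_log_sub_add_sum_range_le (x := -q) (by rw [abs_neg, abs_of_nonneg h0]; linarith) 2
  rw [abs_neg, abs_of_nonneg h0] at h
  have h2 : q ^ (2 + 1) / (1 - q) ≤ 2 * q ^ 3 := by
    rw [div_le_iff₀ (by linarith)]
    have h5 := mul_nonneg (pow_nonneg h0 3) (sub_nonneg.2 h1)
    norm_num only
    linarith
  have h3 := (abs_le.1 (h.trans h2)).2
  simp [Finset.sum_range_succ] at h3
  linarith

lemma le_log_one_add {q : ℝ} (h0 : 0 ≤ q) (h1 : q ≤ 1 / 2) :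
    q - q ^ 2 / 2 - 2 * q ^ 3 ≤ Real.log (1 + q) := by
  have h := Real.abs_log_sub_add_sum_range_le (x := -q) (by rw [abs_neg, abs_of_nonneg h0]; linarith) 2
  rw [abs_neg, abs_of_nonneg h0] at h
  have h2 : q ^ (2 + 1) / (1 - q) ≤ 2 * q ^ 3 := by
    rw [div_le_iff₀ (by linarith)]
    have h5 := mul_nonneg (pow_nonneg h0 3) (sub_nonneg.2 h1)
    norm_num only
    linarith
  have h3 := (abs_le.1 (h.trans h2)).1
  simp [Finset.sum_range_succ] at h3
  linarith

lemma inv_sqrt_pow_eq_exp {a : ℝ} (ha : 0 < a) (C : ℕ) :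
    (√a)⁻¹ ^ C = Real.exp (-(C * Real.log a / 2)) := by
  rw [show -((C : ℝ) * Real.log a / 2) = C * (-(Real.log a / 2)) by ring, Real.exp_nat_mul,
    Real.exp_neg, ← Real.log_sqrt ha.le, Real.exp_log (Real.sqrt_pos.2 ha)]

lemma meanWeight_eq_exp (C : ℕ) (γ : ℝ) : meanWeight C γ
    = Real.exp (C * (γ ^ 2 / (2 * (1 + γ ^ 2)) - Real.log (1 + γ ^ 2) / 2)) := by
  rw [meanWeight, inv_sqrt_pow_eq_exp (by positivity), ← Real.exp_add]
  congr 1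
  ring

lemma pairBound_eq_exp (C : ℕ) (γ L l e : ℝ) : pairBound C γ L l e
    = Real.exp (2 * l * L + (γ - l) ^ 2 * (C + e) / (1 + 2 * γ ^ 2)
      + C * (Real.log (1 + γ ^ 2) - Real.log (1 + 2 * γ ^ 2) / 2 - γ ^ 2 / (1 + γ ^ 2))) := by
  rw [pairBound, inv_sqrt_pow_eq_exp (by positivity), meanWeight_eq_exp, ← Real.exp_nat_mul,
    ← Real.exp_add, ← Real.exp_add, ← Real.exp_sub]
  congr 1
  have : (1 + γ ^ 2) ≠ 0 := by positivity
  push_cast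
  field_simp
  ring

/-- The second-order coefficient must be exact: `-C q'²/2`, with `q' = γ²/(1+2γ²)`, later cancels
the quadratic term in the average of `exp (q' e)`. The `14` collects cubic errors: `4` from `q'`,
`2` from `log (1+q)`, `8` from half of `log (1+2q)`. -/
lemma pairBound_zero_le {C : ℕ} {γ : ℝ} (hq : γ ^ 2 ≤ 1 / 4) (L e : ℝ) : pairBound C γ L 0 e
    ≤ Real.exp (-(C * (γ ^ 2 / (1 + 2 * γ ^ 2)) ^ 2 / 2) + 14 * (C * (γ ^ 2) ^ 3))
      * Real.exp (γ ^ 2 / (1 + 2 * γ ^ 2) * e) := by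
  rw [pairBound_eq_exp, ← Real.exp_add]
  set q := γ ^ 2 with hqdef
  have h0 : 0 ≤ q := sq_nonneg _
  have h1 := log_one_add_le h0 (by linarith)
  have h2 := le_log_one_add (q := 2 * q) (by linarith) (by linarith)
  have h3 : q / (1 + 2 * q) ≤ q - 2 * q ^ 2 + 4 * q ^ 3 := by
    rw [div_le_iff₀ (by linarith)]
    nlinarith [pow_nonneg h0 3, pow_nonneg h0 4]
  have h4 : q - q ^ 2 ≤ q / (1 + q) := by
    rw [le_div_iff₀ (by linarith)]
    nlinarith [pow_nonneg h0 3]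
  have h5 : (q / (1 + 2 * q)) ^ 2 ≤ q ^ 2 := by
    gcongr
    exact div_le_self h0 (by linarith)
  have h6 : q / (1 + 2 * q) + (Real.log (1 + q) - Real.log (1 + 2 * q) / 2 - q / (1 + q))
      ≤ -((q / (1 + 2 * q)) ^ 2 / 2) + 14 * q ^ 3 := by linarith
  have h7 := mul_le_mul_of_nonneg_left h6 (Nat.cast_nonneg (α := ℝ) C)
  apply Real.exp_le_exp.2
  have e1 : (γ - 0) ^ 2 * (C + e) / (1 + 2 * q) = C * (q / (1 + 2 * q)) + q / (1 + 2 * q) * e := by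
    rw [sub_zero, ← hqdef]; ring
  rw [e1]
  linarith

/-- A cruder form for overlaps away from zero: the loss `C γ⁴` is bounded in the regime of use,
which is negligible against exponents of order `N`. -/
lemma pairBound_le {C : ℕ} {γ : ℝ} (hq : γ ^ 2 ≤ 1 / 4) (L l : ℝ) {e : ℝ} (he : 0 ≤ C + e) :
    pairBound C γ L l e
      ≤ Real.exp (2 * l * L + (γ - l) ^ 2 * (C + e) - C * γ ^ 2 + 4 * (C * (γ ^ 2) ^ 2)) := by
  rw [pairBound_eq_exp]
  set q := γ ^ 2 with hqdef
  have h0 : 0 ≤ q := sq_nonneg _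
  have h1 := log_one_add_le h0 (by linarith)
  have h2 := le_log_one_add (q := 2 * q) (by linarith) (by linarith)
  have h4 : q - q ^ 2 ≤ q / (1 + q) := by
    rw [le_div_iff₀ (by linarith)]
    nlinarith [pow_nonneg h0 3]
  have h6 : Real.log (1 + q) - Real.log (1 + 2 * q) / 2 - q / (1 + q) ≤ -q + 4 * q ^ 2 := by
    nlinarith [mul_nonneg (sq_nonneg q) (show 0 ≤ 1 / 4 - q by linarith)]
  have h7 := mul_le_mul_of_nonneg_left h6 (Nat.cast_nonneg (α := ℝ) C)
  have h8 : (γ - l) ^ 2 * (C + e) / (1 + 2 * q) ≤ (γ - l) ^ 2 * (C + e) :=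
    div_le_self (by positivity) (by linarith)
  apply Real.exp_le_exp.2
  linarith

lemma exp_le_quadratic_add (x : ℝ) :
    Real.exp x ≤ 1 + x + x ^ 2 / 2 + |x| ^ 3 * Real.exp |x| := by
  have h := Complex.norm_exp_sub_sum_le_norm_mul_exp (x : ℂ) 3
  rw [Complex.norm_real, Real.norm_eq_abs] at h
  have h2 : Complex.exp x - ∑ m ∈ Finset.range 3, (x : ℂ) ^ m / (m.factorial : ℂ)
      = ((Real.exp x - (1 + x + x ^ 2 / 2) : ℝ) : ℂ) := by
    simp [Finset.sum_range_succ, Nat.factorial]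
  rw [h2, Complex.norm_real, Real.norm_eq_abs] at h
  linarith [(abs_le.1 h).2]

lemma choose_bounds {p N : ℕ} :
    |(p.factorial : ℝ) * N.choose p - (N : ℝ) ^ p| ≤ p.factorial * (N : ℝ) ^ (p - 1) := by
  simpa [symSum_one_config, totalSpin_one] using
    abs_factorial_mul_symSum_sub_le (1 : Config N) p

lemma pow_le_choose {p N : ℕ} (hp : 1 ≤ p) (hN : 2 * p.factorial ≤ N) :
    (N : ℝ) ^ p ≤ 2 * p.factorial * N.choose p := by
  have h := (abs_le.1 (choose_bounds (p := p) (N := N))).1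
  have h1 : 2 * (p.factorial : ℝ) ≤ N := by exact_mod_cast hN
  have h2 : (N : ℝ) ^ p = N ^ (p - 1) * N := by rw [← pow_succ, Nat.sub_add_cancel hp]
  have h3 := mul_le_mul_of_nonneg_left h1 (pow_nonneg (Nat.cast_nonneg (α := ℝ) N) (p - 1))
  nlinarith

/-- Both `e_p` and `N.choose p` are compared with powers divided by `p!`, each at a cost of
`N^(p-1)`. The absolute value covers negative overlaps for either parity of `p`. -/
lemma symSum_le {p N : ℕ} (hN : N ≠ 0) (τ : Config N) :
    symSum p τ ≤ (|totalSpin τ| / N) ^ p * N.choose p + 2 * (N : ℝ) ^ (p - 1) := by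
  have hN' : (0 : ℝ) < N := by exact_mod_cast Nat.pos_of_ne_zero hN
  have hf : (0 : ℝ) < p.factorial := by exact_mod_cast p.factorial_pos
  set r := |totalSpin τ| / N with hr
  have hr0 : 0 ≤ r := by positivity
  have hr1 : r ≤ 1 := by rw [hr, div_le_one hN']; exact abs_totalSpin_le τ
  have h1 := (abs_le.1 (abs_factorial_mul_symSum_sub_le τ p)).2
  have h2 := (abs_le.1 (choose_bounds (p := p) (N := N))).1
  have h3 : totalSpin τ ^ p ≤ r ^ p * (N : ℝ) ^ p := by
    rw [← mul_pow, hr, div_mul_cancel₀ _ hN'.ne', ← abs_pow]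
    exact le_abs_self _
  have h4 : r ^ p ≤ 1 := pow_le_one₀ hr0 hr1
  have h5 : (N : ℝ) ^ p ≤ p.factorial * N.choose p + p.factorial * (N : ℝ) ^ (p - 1) := by linarith
  have h6 := mul_le_mul_of_nonneg_left h5 (pow_nonneg hr0 p)
  have h7 : r ^ p * (p.factorial * (N : ℝ) ^ (p - 1)) ≤ p.factorial * (N : ℝ) ^ (p - 1) :=
    mul_le_of_le_one_left (by positivity) h4
  have h8 : (p.factorial : ℝ) * symSum p τ
      ≤ p.factorial * (r ^ p * N.choose p + 2 * (N : ℝ) ^ (p - 1)) := by nlinarith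
  exact le_of_mul_le_mul_left h8 hf

lemma choose_add_symSum_nonneg {p N : ℕ} (τ : Config N) : 0 ≤ (N.choose p : ℝ) + symSum p τ := by
  have h1 : ∀ A : Finset (Fin N), -1 ≤ spinProd τ A := fun A => by
    nlinarith [spinProd_sq τ A]
  have h : ∑ A ∈ Finset.powersetCard p (Finset.univ : Finset (Fin N)), (-1 : ℝ) ≤ symSum p τ :=
    Finset.sum_le_sum fun A _ => h1 A
  simp at h
  linarith

/-! ### Far and near overlaps in the second moment -/

/-- Contribution of one overlap bounded away from zero. -/
lemma pairBound_far_le {p N : ℕ} (hp : 2 ≤ p) (hN : 2 * p.factorial ≤ N) {β ε δ κ : ℝ}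
    (hβ : 0 ≤ β) (hε : 0 ≤ ε) (hδ : 0 < δ) (hκ : 0 ≤ κ) (hcrit : β ^ 2 + κ ≤ betaCrit p ^ 2)
    (hsmall : 2 * β * ε ≤ κ * δ ^ p / 4)
    (hq : β ^ 2 * N / N.choose p ≤ 1 / 4) (τ : Config N) (hτ : δ * N ≤ |totalSpin τ|) :
    pairBound (N.choose p) (β * √N / √(N.choose p : ℝ)) ((β + ε) * √N * √(N.choose p : ℝ))
        (β * √N / √(N.choose p : ℝ) * ((|totalSpin τ| / N) ^ p / (1 + (|totalSpin τ| / N) ^ p)))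
        (symSum p τ)
      ≤ Real.exp (4 * β ^ 2 * p.factorial + 8 * β ^ 4 * p.factorial)
        * Real.exp (-(κ * δ ^ p / 4) * N) * Real.exp (N * phi (totalSpin τ / N)) := by
  have hf : (1 : ℝ) ≤ p.factorial := by exact_mod_cast p.factorial_pos
  have hN0 : 0 < N := by have := p.factorial_pos; omega
  have hN' : (0 : ℝ) < N := by exact_mod_cast hN0
  have hN1 : (1 : ℝ) ≤ N := by exact_mod_cast hN0
  have hpow := pow_le_choose (by omega) hN
  have hC : (0 : ℝ) < N.choose p := by
    have : 0 < (N : ℝ) ^ p := by positivity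
    nlinarith
  set C : ℝ := (N.choose p : ℝ) with hCdef
  set r := |totalSpin τ| / N with hr
  have hr0 : δ ≤ r := by rw [hr, le_div_iff₀ hN']; exact hτ
  have hr1 : r ≤ 1 := by rw [hr, div_le_one hN']; exact abs_totalSpin_le τ
  have hrpos : 0 < r := hδ.trans_le hr0
  set ρ := r ^ p with hρ
  have hρ0 : 0 < ρ := pow_pos hrpos p
  have hρ1 : ρ ≤ 1 := pow_le_one₀ hrpos.le hr1
  have hρδ : δ ^ p ≤ ρ := pow_le_pow_left₀ hδ.le hr0 p
  have hsN : √(N : ℝ) ^ 2 = N := Real.sq_sqrt hN'.le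
  have hsC : √C ^ 2 = C := Real.sq_sqrt hC.le
  have hsC0 : √C ≠ 0 := (Real.sqrt_pos.2 hC).ne'
  have hγ : (β * √N / √C) ^ 2 = β ^ 2 * N / C := by rw [div_pow, mul_pow, hsN, hsC]
  refine (pairBound_le (by rw [hγ]; exact hq) _ _ (choose_add_symSum_nonneg τ)).trans ?_
  rw [← Real.exp_add, ← Real.exp_add]
  apply Real.exp_le_exp.2
  rw [hγ, ← hCdef]
  have hphi : phi (totalSpin τ / N) = phi r := by
    rw [← phi_abs, abs_div, Nat.abs_cast]
  rw [hphi]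
  have hcr := betaCrit_sq_mul_le_phi p hrpos hr1
  -- The tilt `l = γρ/(1+ρ)` minimises `2lL + (γ-l)² C(1+ρ)` at `ε = 0`. With `s = ρ/(1+ρ)` the
  -- leading exponent becomes `N (β² s + 2βε s)`.
  have e1 : 2 * (β * √N / √C * (ρ / (1 + ρ))) * ((β + ε) * √N * √C)
      = 2 * β * (β + ε) * N * (ρ / (1 + ρ)) := by
    have : 2 * (β * √N / √C * (ρ / (1 + ρ))) * ((β + ε) * √N * √C)
      = 2 * β * (β + ε) * √N ^ 2 * (ρ / (1 + ρ)) * (√C / √C) := by ring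
    rw [this, hsN, div_self hsC0, mul_one]
  have e2 : (β * √N / √C - β * √N / √C * (ρ / (1 + ρ))) ^ 2 = β ^ 2 * N / C * (1 / (1 + ρ)) ^ 2 := by
    rw [← hγ]; field_simp; ring
  have hsym : C + symSum p τ ≤ C * (1 + ρ) + 2 * (N : ℝ) ^ (p - 1) := by
    have := symSum_le (p := p) hN0.ne' τ
    rw [← hCdef, ← hr, ← hρ] at this
    linarith
  have hNC : (N : ℝ) * N ^ (p - 1) / C ≤ 2 * p.factorial := by
    rw [div_le_iff₀ hC, ← pow_succ', Nat.sub_add_cancel (by omega)]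
    exact hpow
  have e3 : β ^ 2 * N / C * (1 / (1 + ρ)) ^ 2 * (C + symSum p τ)
      ≤ β ^ 2 * N * (1 / (1 + ρ)) + 4 * β ^ 2 * p.factorial := by
    calc _ ≤ β ^ 2 * N / C * (1 / (1 + ρ)) ^ 2 * (C * (1 + ρ) + 2 * (N : ℝ) ^ (p - 1)) := by gcongr
      _ = β ^ 2 * N * (1 / (1 + ρ))
          + 2 * β ^ 2 * (N * (N : ℝ) ^ (p - 1) / C) * (1 / (1 + ρ)) ^ 2 := by field_simp
      _ ≤ β ^ 2 * N * (1 / (1 + ρ)) + 2 * β ^ 2 * (2 * p.factorial) * 1 ^ 2 := by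
          gcongr
          rw [div_le_one (by positivity)]
          linarith
      _ = _ := by ring
  have e4 : 4 * (C * (β ^ 2 * N / C) ^ 2) ≤ 8 * β ^ 4 * p.factorial := by
    have h : (N : ℝ) ^ 2 / C ≤ 2 * p.factorial := by
      rw [div_le_iff₀ hC]
      exact (pow_le_pow_right₀ hN1 hp).trans hpow
    calc _ = 4 * β ^ 4 * ((N : ℝ) ^ 2 / C) := by field_simp
      _ ≤ 4 * β ^ 4 * (2 * p.factorial) := by gcongr
      _ = _ := by ring
  have e5 : C * (β ^ 2 * N / C) = β ^ 2 * N := by field_simp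
  rw [e1, e2, e5]
  set s := ρ / (1 + ρ) with hs
  have hs1 : 1 / (1 + ρ) = 1 - s := by rw [hs]; field_simp; ring
  have hs0 : 0 ≤ s := by positivity
  have hsle : s ≤ 1 := by rw [hs, div_le_one (by positivity)]; linarith
  have hslow : δ ^ p / 2 ≤ s := by
    rw [hs, div_le_div_iff₀ (by norm_num) (by positivity)]
    nlinarith [pow_pos hδ p]
  have hphi' : betaCrit p ^ 2 * s ≤ phi r := by
    rw [hs, ← mul_div_assoc, div_le_iff₀ (by positivity)]
    linarith
  -- The gap `κ` below the threshold gains `κδ^p/2`; `ε` spends at most half of it, leaving the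
  -- decay rate `κδ^p/4`.
  have h1 : β ^ 2 * s + κ * (δ ^ p / 2) ≤ phi r := by
    calc _ ≤ β ^ 2 * s + κ * s := by gcongr
      _ = (β ^ 2 + κ) * s := by ring
      _ ≤ betaCrit p ^ 2 * s := by gcongr
      _ ≤ _ := hphi'
  have h2 : 2 * β * ε * s ≤ κ * δ ^ p / 4 :=
    (mul_le_of_le_one_right (by positivity) hsle).trans hsmall
  rw [hs1] at e3
  rw [hs1]
  have h3 : β ^ 2 * s + 2 * β * ε * s ≤ phi r - κ * δ ^ p / 4 := by linarith
  have h4 := mul_le_mul_of_nonneg_left h3 hN'.le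
  linarith [e3, e4, h4]

/-- Contribution of one overlap close to zero. -/
lemma exp_mul_symSum_le {p N : ℕ} (hp : 3 ≤ p) (hN0 : N ≠ 0) {q K δ : ℝ} (hK : 0 ≤ K)
    (hδ1 : δ ≤ 1) (hδ : 0 ≤ δ) (hKδ : K * δ ≤ 1 / 8)
    (hδN : √(N : ℝ) ≤ δ * N) (hq0 : 0 ≤ q)
    (hq : q * N ^ p ≤ K * N) (τ : Config N) (hτ : |totalSpin τ| ≤ δ * N) :
    Real.exp (q * symSum p τ) ≤ 1 + q * symSum p τ + (q ^ 2 / 2) * symSum p τ ^ 2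
      + (2 * K ^ 3 * ((3 * p).factorial * 8 ^ (3 * p)) * (N ^ 3 / √(N : ℝ) ^ (3 * p)))
        * Real.exp (totalSpin τ ^ 2 / (4 * N)) := by
  have hN' : (0 : ℝ) < N := by exact_mod_cast Nat.pos_of_ne_zero hN0
  have hN1 : (1 : ℝ) ≤ N := by exact_mod_cast Nat.pos_of_ne_zero hN0
  have hs1 : 1 ≤ √(N : ℝ) := Real.one_le_sqrt.2 hN1
  have hsN : √(N : ℝ) ^ 2 = N := Real.sq_sqrt hN'.le
  -- The floor `√N` ensures `N ≤ T²`, as the bound on symmetric sums requires.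
  set T := max |totalSpin τ| √(N : ℝ) with hT
  have hsT : √(N : ℝ) ≤ T := le_max_right _ _
  have hT1 : 1 ≤ T := hs1.trans hsT
  have hT0 : 0 < T := by linarith
  have hTδ : T ≤ δ * N := max_le hτ hδN
  have hTsq : T ^ 2 ≤ totalSpin τ ^ 2 + N := by
    rcases max_choice |totalSpin τ| √(N : ℝ) with h | h
    · rw [hT, h, sq_abs]; linarith
    · rw [hT, h, hsN]; nlinarith [sq_nonneg (totalSpin τ)]
  have hsym : |symSum p τ| ≤ T ^ p :=
    abs_symSum_le hT1 τ (le_max_left _ _) (by rw [← hsN]; gcongr) p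
  set W := q * symSum p τ with hW
  have hWabs : |W| ≤ q * T ^ p := by
    rw [hW, abs_mul, abs_of_nonneg hq0]
    gcongr
  set u := T / √(N : ℝ) with hu
  have hu1 : 1 ≤ u := by rw [hu, one_le_div (by positivity)]; exact hsT
  have hu2 : u ^ 2 = T ^ 2 / N := by rw [hu, div_pow, hsN]
  -- Here `p ≥ 3` enters: `T^(p-2)` contains at least one factor `T ≤ δN`, so smallness of `δ` keeps
  -- `|W|` below a small multiple of `T²/N`.
  have hWexp : |W| ≤ u ^ 2 / 8 := by
    obtain ⟨k, rfl⟩ : ∃ k, p = k + 3 := ⟨p - 3, by omega⟩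
    have hTp : T ^ (k + 1) ≤ δ * (N : ℝ) ^ (k + 1) := by
      calc T ^ (k + 1) ≤ (δ * N) ^ (k + 1) := by gcongr
        _ = δ ^ k * δ * (N : ℝ) ^ (k + 1) := by ring
        _ ≤ 1 * δ * (N : ℝ) ^ (k + 1) := by
            gcongr
            exact pow_le_one₀ hδ hδ1
        _ = _ := by ring
    rw [hu2, div_div, le_div_iff₀ (by positivity)]
    calc |W| * (N * 8) ≤ (q * T ^ (k + 3)) * (N * 8) := by gcongr
      _ = 8 * T ^ 2 * (q * N * T ^ (k + 1)) := by ring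
      _ ≤ 8 * T ^ 2 * (q * N * (δ * (N : ℝ) ^ (k + 1))) := by gcongr
      _ = 8 * T ^ 2 * (δ * (q * (N : ℝ) ^ (k + 3)) / N) := by
          field_simp
          ring
      _ ≤ 8 * T ^ 2 * (δ * (K * N) / N) := by gcongr
      _ = T ^ 2 * (8 * (K * δ)) := by field_simp
      _ ≤ T ^ 2 * (8 * (1 / 8)) := by gcongr
      _ = _ := by ring
  have hWcube : |W| ^ 3 ≤ K ^ 3 * (N ^ 3 / √(N : ℝ) ^ (3 * p)) * u ^ (3 * p) := by
    have h1 : q * T ^ p ≤ K * (N / √(N : ℝ) ^ p) * u ^ p := by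
      rw [hu, div_pow]
      have h2 : K * (N / √(N : ℝ) ^ p) * (T ^ p / √(N : ℝ) ^ p) = K * N / (N : ℝ) ^ p * T ^ p := by
        have : (N : ℝ) ^ p = √(N : ℝ) ^ p * √(N : ℝ) ^ p := by rw [← mul_pow, ← sq, hsN]
        rw [this]
        field_simp
      rw [h2]
      gcongr
      rw [le_div_iff₀ (by positivity)]
      exact hq
    calc |W| ^ 3 ≤ (K * (N / √(N : ℝ) ^ p) * u ^ p) ^ 3 := by
          gcongr
          exact hWabs.trans h1
      _ = _ := by rw [mul_pow, mul_pow, div_pow, ← pow_mul, ← pow_mul, mul_comm p 3]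
  have hupow : u ^ (3 * p) ≤ ((3 * p).factorial * 8 ^ (3 * p)) * Real.exp (u ^ 2 / 8) := by
    have h := Real.pow_div_factorial_le_exp (u ^ 2 / 8) (by positivity) (3 * p)
    rw [div_pow, div_div, div_le_iff₀ (by positivity)] at h
    calc u ^ (3 * p) ≤ (u ^ 2) ^ (3 * p) := by
          gcongr
          nlinarith
      _ ≤ _ := by linarith
  -- One factor comes from `exp |W|`, the other from absorbing `u^(3p)`; the rate `1/4` is what the
  -- exponential moment of `S²/N` allows, and `exp (1/4) ≤ 2`.
  have hexp2 : Real.exp (u ^ 2 / 8) * Real.exp (u ^ 2 / 8)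
      ≤ 2 * Real.exp (totalSpin τ ^ 2 / (4 * N)) := by
    rw [← Real.exp_add]
    have h1 : u ^ 2 / 8 + u ^ 2 / 8 ≤ 1 / 4 + totalSpin τ ^ 2 / (4 * N) := by
      have : u ^ 2 ≤ totalSpin τ ^ 2 / N + 1 := by
        rw [hu2, div_le_iff₀ hN', add_mul, div_mul_cancel₀ _ hN'.ne']
        linarith
      have e : totalSpin τ ^ 2 / (4 * N) = (totalSpin τ ^ 2 / N) / 4 := by field_simp
      rw [e]
      linarith
    refine (Real.exp_le_exp.2 h1).trans ?_
    rw [Real.exp_add]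
    gcongr
    have h3 : (1 / 4 : ℝ) ≤ Real.log 2 := by linarith [Real.log_two_gt_d9]
    exact (Real.le_log_iff_exp_le (by norm_num)).1 h3
  refine (exp_le_quadratic_add W).trans ?_
  have hlast : |W| ^ 3 * Real.exp |W|
      ≤ (2 * K ^ 3 * ((3 * p).factorial * 8 ^ (3 * p)) * (N ^ 3 / √(N : ℝ) ^ (3 * p)))
        * Real.exp (totalSpin τ ^ 2 / (4 * N)) := by
    calc |W| ^ 3 * Real.exp |W|
        ≤ (K ^ 3 * (N ^ 3 / √(N : ℝ) ^ (3 * p))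
            * (((3 * p).factorial * 8 ^ (3 * p)) * Real.exp (u ^ 2 / 8))) * Real.exp (u ^ 2 / 8) := by
          gcongr
          exact hWcube.trans (by gcongr)
      _ = K ^ 3 * (N ^ 3 / √(N : ℝ) ^ (3 * p)) * ((3 * p).factorial * 8 ^ (3 * p))
            * (Real.exp (u ^ 2 / 8) * Real.exp (u ^ 2 / 8)) := by ring
      _ ≤ K ^ 3 * (N ^ 3 / √(N : ℝ) ^ (3 * p)) * ((3 * p).factorial * 8 ^ (3 * p))
            * (2 * Real.exp (totalSpin τ ^ 2 / (4 * N))) := by gcongr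
      _ = _ := by ring
  have : W ^ 2 / 2 = (q ^ 2 / 2) * symSum p τ ^ 2 := by rw [hW]; ring
  linarith

lemma tendsto_cube_div_sqrt_pow {p : ℕ} (hp : 3 ≤ p) :
    Tendsto (fun N : ℕ => (N : ℝ) ^ 3 / √(N : ℝ) ^ (3 * p)) atTop (nhds 0) := by
  have h : Tendsto (fun N : ℕ => (√(N : ℝ) ^ (3 * p - 6))⁻¹) atTop (nhds 0) :=
    ((tendsto_pow_atTop (by omega)).comp
      (Real.tendsto_sqrt_atTop.comp tendsto_natCast_atTop_atTop)).inv_tendsto_atTop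
  refine h.congr' ?_
  filter_upwards [eventually_ge_atTop 1] with N hN
  have hN' : (0 : ℝ) < N := by exact_mod_cast hN
  have hs : (0 : ℝ) < √(N : ℝ) := Real.sqrt_pos.2 hN'
  have e1 : (N : ℝ) ^ 3 = √(N : ℝ) ^ 6 := by
    rw [show (6 : ℕ) = 2 * 3 by norm_num, pow_mul, Real.sq_sqrt hN'.le]
  have e2 : √(N : ℝ) ^ (3 * p) = √(N : ℝ) ^ (3 * p - 6) * √(N : ℝ) ^ 6 := by
    rw [← pow_add]; congr 1; omega
  rw [e1, e2]
  field_simp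

set_option maxHeartbeats 2000000 in
/-- The second moment of the low energy part of the normalised partition function: the averaged
pair correlation exceeds `1` by `o(N ^ (2 - p))`. -/
lemma exists_avg_pairBound_le {p : ℕ} (hp : 3 ≤ p) {β : ℝ} (hβ : 0 ≤ β) (hβ' : β < betaCrit p) :
    ∃ ε > 0, ∃ K, ∃ c > 0, ∀ᶠ N : ℕ in atTop, ∃ l : Config N → ℝ, (∀ τ, 0 ≤ l τ) ∧
      avg (fun τ => pairBound (N.choose p) (β * √N / √(N.choose p : ℝ))
          ((β + ε) * √N * √(N.choose p : ℝ)) (l τ) (symSum p τ))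
        ≤ 1 + K * ((N : ℝ) ^ 3 / √(N : ℝ) ^ (3 * p)) + K * ((2 * N + 1) * Real.exp (-c * N)) := by
  -- This makes `γ² N^p ≤ K0 N`, since `N^p ≤ 2 p! C`.
  set K0 : ℝ := 2 * β ^ 2 * p.factorial with hK0
  have hK0' : 0 ≤ K0 := by positivity
  set δ : ℝ := 1 / (8 * (K0 + 1)) with hδdef
  have hδ : 0 < δ := by positivity
  have hδ1 : δ ≤ 1 := by
    rw [hδdef, div_le_one (by positivity)]; linarith
  have hKδ : K0 * δ ≤ 1 / 8 := by
    rw [hδdef, mul_one_div, div_le_div_iff₀ (by positivity) (by norm_num)]; linarith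
  set κ : ℝ := betaCrit p ^ 2 - β ^ 2 with hκdef
  have hκ : 0 < κ := by
    rw [hκdef]; nlinarith
  set ε : ℝ := κ * δ ^ p / (8 * (β + 1)) with hεdef
  have hε : 0 < ε := by positivity
  have hsmall : 2 * β * ε ≤ κ * δ ^ p / 4 := by
    rw [hεdef, ← mul_div_assoc, div_le_div_iff₀ (by positivity) (by norm_num)]
    have : 0 < κ * δ ^ p := by positivity
    nlinarith
  set K1 : ℝ := 2 * K0 ^ 3 * ((3 * p).factorial * 8 ^ (3 * p)) with hK1
  have hK1' : 0 ≤ K1 := by positivity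
  set K2 : ℝ := Real.exp (4 * β ^ 2 * p.factorial + 8 * β ^ 4 * p.factorial) with hK2
  set Ka : ℝ := 2 * (14 * (β ^ 2 * K0 ^ 2) + 2 * K1) with hKa
  have hKa' : 0 ≤ Ka := by positivity
  refine ⟨ε, hε, max Ka K2, κ * δ ^ p / 4, by positivity, ?_⟩
  have hx := tendsto_cube_div_sqrt_pow hp
  have hev1 : ∀ᶠ N : ℕ in atTop, Ka * ((N : ℝ) ^ 3 / √(N : ℝ) ^ (3 * p)) ≤ 1 := by
    have := hx.const_mul Ka
    rw [mul_zero] at this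
    exact this.eventually_le_const one_pos
  have hev2 : ∀ᶠ N : ℕ in atTop, 1 / δ ≤ √(N : ℝ) :=
    (Real.tendsto_sqrt_atTop.comp tendsto_natCast_atTop_atTop).eventually_ge_atTop _
  have hev3 : ∀ᶠ N : ℕ in atTop, 4 * K0 ≤ (N : ℝ) :=
    tendsto_natCast_atTop_atTop.eventually_ge_atTop _
  filter_upwards [hev1, hev2, hev3, eventually_ge_atTop (2 * p.factorial)] with N h1 h2 h3 hN
  have hf : (1 : ℝ) ≤ p.factorial := by exact_mod_cast p.factorial_pos
  have hN0 : 0 < N := by have := p.factorial_pos; omega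
  have hN' : (0 : ℝ) < N := by exact_mod_cast hN0
  have hN1 : (1 : ℝ) ≤ N := by exact_mod_cast hN0
  have hsN : √(N : ℝ) ^ 2 = N := Real.sq_sqrt hN'.le
  have hs1 : 1 ≤ √(N : ℝ) := Real.one_le_sqrt.2 hN1
  have hpow := pow_le_choose (by omega) hN
  have hC : (0 : ℝ) < N.choose p := by
    have : 0 < (N : ℝ) ^ p := by positivity
    nlinarith
  set C : ℝ := (N.choose p : ℝ) with hCdef
  have hsC : √C ^ 2 = C := Real.sq_sqrt hC.le
  set γ : ℝ := β * √N / √C with hγdef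
  have hγ : γ ^ 2 = β ^ 2 * N / C := by rw [hγdef, div_pow, mul_pow, hsN, hsC]
  have hδN : √(N : ℝ) ≤ δ * N := by
    rw [div_le_iff₀ hδ] at h2
    nlinarith
  set q : ℝ := γ ^ 2 with hq
  have hq0 : 0 ≤ q := sq_nonneg _
  have hqpow : q * (N : ℝ) ^ p ≤ K0 * N := by
    rw [hγ, div_mul_eq_mul_div, div_le_iff₀ hC]
    calc β ^ 2 * N * (N : ℝ) ^ p ≤ β ^ 2 * N * (2 * p.factorial * C) := by gcongr
      _ = _ := by rw [hK0]; ring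
  have hqs : q ≤ 1 / 4 := by
    have hNN : (N : ℝ) ^ 2 ≤ (N : ℝ) ^ p := pow_le_pow_right₀ hN1 (by omega)
    have : q * (N : ℝ) ^ 2 ≤ K0 * N := (mul_le_mul_of_nonneg_left hNN hq0).trans hqpow
    have : q * N ≤ K0 := by
      refine le_of_mul_le_mul_right ?_ hN'
      linarith
    nlinarith
  set q' : ℝ := q / (1 + 2 * q) with hq'
  have hq'0 : 0 ≤ q' := by positivity
  have hq'q : q' ≤ q := div_le_self hq0 (by linarith)
  have hq'pow : q' * (N : ℝ) ^ p ≤ K0 * N := (by gcongr : q' * (N : ℝ) ^ p ≤ q * N ^ p).trans hqpow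
  set x : ℝ := (N : ℝ) ^ 3 / √(N : ℝ) ^ (3 * p) with hxdef
  have hx0 : 0 ≤ x := by positivity
  have hCq3 : C * q ^ 3 ≤ β ^ 2 * K0 ^ 2 * x := by
    have e0 : √(N : ℝ) ^ (4 * p) = ((N : ℝ) ^ p) ^ 2 := by
      rw [show 4 * p = 2 * (p * 2) by ring, pow_mul, hsN, pow_mul]
    have e1 : C * q ^ 3 = β ^ 2 * N * q ^ 2 := by
      have : C * q = β ^ 2 * N := by rw [hγ]; field_simp
      linear_combination q ^ 2 * this
    have e2 : q ^ 2 ≤ K0 ^ 2 * (N ^ 2 / √(N : ℝ) ^ (3 * p)) := by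
      rw [← mul_div_assoc, le_div_iff₀ (by positivity), ← mul_pow]
      calc q ^ 2 * √(N : ℝ) ^ (3 * p) ≤ q ^ 2 * √(N : ℝ) ^ (4 * p) :=
            mul_le_mul_of_nonneg_left (pow_le_pow_right₀ hs1 (by omega)) (by positivity)
        _ = (q * (N : ℝ) ^ p) ^ 2 := by rw [e0, mul_pow]
        _ ≤ _ := by gcongr
    calc C * q ^ 3 = β ^ 2 * N * q ^ 2 := e1
      _ ≤ β ^ 2 * N * (K0 ^ 2 * (N ^ 2 / √(N : ℝ) ^ (3 * p))) := by gcongr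
      _ = _ := by rw [hxdef]; ring
  set D : ℝ := Real.exp (-(C * q' ^ 2 / 2) + 14 * (C * q ^ 3)) with hD
  have hD0 : 0 < D := Real.exp_pos _
  set ρ : Config N → ℝ := fun τ => (|totalSpin τ| / N) ^ p / (1 + (|totalSpin τ| / N) ^ p) with hρ
  have hγ0 : 0 ≤ γ := by positivity
  classical
  refine ⟨fun τ => if |totalSpin τ| ≤ δ * N then 0 else γ * ρ τ, ?_, ?_⟩
  · intro τ
    dsimp only
    split_ifs
    · exact le_rfl
    · have : 0 ≤ ρ τ := by positivity
      positivity
  have hpt : ∀ τ : Config N, pairBound (N.choose p) γ ((β + ε) * √N * √C)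
        (if |totalSpin τ| ≤ δ * N then 0 else γ * ρ τ) (symSum p τ)
      ≤ D * (1 + (q' * symSum p τ + ((q' ^ 2 / 2) * symSum p τ ^ 2
          + (K1 * x) * Real.exp (totalSpin τ ^ 2 / (4 * N)))))
        + (K2 * Real.exp (-(κ * δ ^ p / 4) * N)) * Real.exp (N * phi (totalSpin τ / N)) := by
    intro τ
    -- Both contributions are nonnegative, the near one because `1 + W + W²/2 > 0`. Each can
    -- therefore be averaged over all configurations, where the linear term vanishes exactly.
    have hr1 : 0 ≤ (K2 * Real.exp (-(κ * δ ^ p / 4) * N))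
        * Real.exp (N * phi (totalSpin τ / N)) := by positivity
    have hr2 : 0 ≤ D * (1 + (q' * symSum p τ + ((q' ^ 2 / 2) * symSum p τ ^ 2
          + (K1 * x) * Real.exp (totalSpin τ ^ 2 / (4 * N))))) := by
      have : 0 ≤ (K1 * x) * Real.exp (totalSpin τ ^ 2 / (4 * N)) := by positivity
      refine mul_nonneg hD0.le ?_
      nlinarith [sq_nonneg (1 + q' * symSum p τ)]
    split_ifs with h
    · have ha := pairBound_zero_le (C := N.choose p) (γ := γ) hqs ((β + ε) * √N * √C) (symSum p τ)
      have hb := exp_mul_symSum_le hp hN0.ne' hK0' hδ1 hδ.le hKδ hδN hq'0 hq'pow τ h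
      refine (ha.trans (mul_le_mul_of_nonneg_left hb hD0.le)).trans ?_
      rw [← hK1, ← hxdef]
      linarith
    · have := pairBound_far_le (p := p) (by omega) hN hβ hε.le hδ hκ.le
        (by rw [hκdef]; linarith) hsmall (by rw [← hγ]; exact hqs) τ (not_le.1 h).le
      refine this.trans ?_
      linarith
  refine (avg_mono hpt).trans ?_
  rw [avg_add, avg_const_mul, avg_add, avg_const, avg_add, avg_const_mul, avg_add, avg_const_mul,
    avg_const_mul, avg_const_mul, avg_symSum (by omega), avg_symSum_sq, ← hCdef]
  have hA := avg_exp_sq_totalSpin_le hN0.ne'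
  have hB := avg_exp_mul_phi_le hN0.ne'
  -- As `e_p` has second moment `C`, the quadratic term is absorbed by `exp (C q'²/2)` and cancels
  -- against `D`.
  have hmain : D * (1 + (q' * 0 + (q' ^ 2 / 2 * C + K1 * x
      * avg (fun τ : Config N => Real.exp (totalSpin τ ^ 2 / (4 * N)))))) ≤ 1 + Ka * x := by
    have hy : 14 * (C * q ^ 3) + 2 * (K1 * x) ≤ Ka * x / 2 := by
      rw [hKa]; linarith
    have hy0 : 0 ≤ 14 * (C * q ^ 3) + 2 * (K1 * x) := by positivity
    calc _ ≤ D * Real.exp (C * q' ^ 2 / 2 + 2 * (K1 * x)) := by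
          refine mul_le_mul_of_nonneg_left ?_ hD0.le
          have := Real.add_one_le_exp (C * q' ^ 2 / 2 + 2 * (K1 * x))
          have h5 := mul_le_mul_of_nonneg_left hA (show 0 ≤ K1 * x by positivity)
          linarith
      _ = Real.exp (14 * (C * q ^ 3) + 2 * (K1 * x)) := by
          rw [hD, ← Real.exp_add]; congr 1; ring
      _ ≤ 1 + 2 * (14 * (C * q ^ 3) + 2 * (K1 * x)) := by
          have := Real.abs_exp_sub_one_le (x := 14 * (C * q ^ 3) + 2 * (K1 * x))
            (by rw [abs_of_nonneg hy0]; linarith)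
          rw [abs_of_nonneg hy0] at this
          linarith [(abs_le.1 this).2]
      _ ≤ _ := by linarith
  have hfar : K2 * Real.exp (-(κ * δ ^ p / 4) * N)
      * avg (fun τ : Config N => Real.exp (N * phi (totalSpin τ / N)))
      ≤ K2 * ((2 * N + 1) * Real.exp (-(κ * δ ^ p / 4) * N)) := by
    rw [mul_assoc, mul_comm (2 * (N : ℝ) + 1)]
    gcongr
  have h6 : Ka * x ≤ max Ka K2 * x := mul_le_mul_of_nonneg_right (le_max_left _ _) hx0
  have h7 : K2 * ((2 * N + 1) * Real.exp (-(κ * δ ^ p / 4) * N))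
      ≤ max Ka K2 * ((2 * N + 1) * Real.exp (-(κ * δ ^ p / 4) * N)) :=
    mul_le_mul_of_nonneg_right (le_max_right _ _) (by positivity)
  linarith

/-! ### Gaussian moments and the central limit theorem for squared couplings -/

lemma hasDerivAt_exp_half_sq (t : ℝ) :
    HasDerivAt (fun t : ℝ => Real.exp (t ^ 2 / 2)) (t * Real.exp (t ^ 2 / 2)) t := by
  have h := ((hasDerivAt_pow 2 t).div_const 2).exp
  convert! h using 1
  simp
  ring

lemma integral_pow_four_gaussianReal : ∫ x, x ^ 4 ∂(gaussianReal 0 1) = 3 := by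
  have h := iteratedDeriv_mgf_zero (X := id) (μ := gaussianReal 0 1)
    (by rw [integrableExpSet_id_gaussianReal]; simp) 4
  have hm : mgf id (gaussianReal 0 1) = fun t => Real.exp (t ^ 2 / 2) := by
    rw [mgf_id_gaussianReal]; ext t; simp
  have d1 : deriv (fun t : ℝ => Real.exp (t ^ 2 / 2)) = fun t => t * Real.exp (t ^ 2 / 2) :=
    funext fun t => (hasDerivAt_exp_half_sq t).deriv
  have d2 : deriv (fun t : ℝ => t * Real.exp (t ^ 2 / 2))
      = fun t => (1 + t ^ 2) * Real.exp (t ^ 2 / 2) := funext fun t => by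
    rw [((hasDerivAt_id' t).fun_mul (hasDerivAt_exp_half_sq t)).deriv]; simp; ring
  have d3 : deriv (fun t : ℝ => (1 + t ^ 2) * Real.exp (t ^ 2 / 2))
      = fun t => (3 * t + t ^ 3) * Real.exp (t ^ 2 / 2) := funext fun t => by
    rw [(((hasDerivAt_pow 2 t).const_add 1).fun_mul (hasDerivAt_exp_half_sq t)).deriv]; simp; ring
  have d4 : deriv (fun t : ℝ => (3 * t + t ^ 3) * Real.exp (t ^ 2 / 2)) 0 = 3 := by
    rw [((((hasDerivAt_id' (0 : ℝ)).const_mul 3).fun_add (hasDerivAt_pow 3 0)).fun_mul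
      (hasDerivAt_exp_half_sq 0)).deriv]
    simp
  rw [hm, iteratedDeriv_succ, iteratedDeriv_succ, iteratedDeriv_succ, iteratedDeriv_one,
    d1, d2, d3, d4] at h
  simpa using h.symm

lemma integral_sq_gaussianReal : ∫ x, x ^ 2 ∂(gaussianReal 0 1) = 1 := by
  have h := variance_fun_id_gaussianReal (μ := 0) (v := 1)
  rw [variance_eq_integral (by fun_prop)] at h
  simpa [integral_id_gaussianReal] using h

lemma integrable_pow_gaussianReal (k : ℕ) : Integrable (fun x : ℝ => x ^ k) (gaussianReal 0 1) := by
  rcases Nat.eq_zero_or_pos k with rfl | hk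
  · simp
  have h := (memLp_id_gaussianReal (μ := 0) (v := 1) k).integrable_norm_pow hk.ne'
  refine h.mono (by fun_prop) (Eventually.of_forall fun x => ?_)
  simp

/-- The centred and normalised square of a standard normal variable. -/
def centredSq (x : ℝ) : ℝ := (x ^ 2 - 1) / √2

lemma measurable_centredSq : Measurable centredSq := by
  unfold centredSq; fun_prop

lemma integral_centredSq : ∫ x, centredSq x ∂(gaussianReal 0 1) = 0 := by
  unfold centredSq
  rw [integral_div, integral_sub (integrable_pow_gaussianReal 2) (integrable_const _),
    integral_sq_gaussianReal]
  simp

lemma integral_centredSq_sq : ∫ x, centredSq x ^ 2 ∂(gaussianReal 0 1) = 1 := by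
  have h : ∀ x, centredSq x ^ 2 = (x ^ 4 - 2 * x ^ 2 + 1) / 2 := fun x => by
    rw [centredSq, div_pow, Real.sq_sqrt (by norm_num)]; ring
  simp only [h]
  have h4 := integrable_pow_gaussianReal 4
  have h2 := (integrable_pow_gaussianReal 2).const_mul 2
  rw [integral_div, integral_add (f := fun x : ℝ => x ^ 4 - 2 * x ^ 2) (h4.sub h2)
    (integrable_const _), integral_sub h4 h2, integral_const_mul, integral_sq_gaussianReal,
    integral_pow_four_gaussianReal]
  simp
  norm_num

lemma tendsto_choose_atTop {p : ℕ} (hp : 1 ≤ p) :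
    Tendsto (fun N : ℕ => N.choose p) atTop atTop := by
  rw [← tendsto_natCast_atTop_iff (R := ℝ)]
  have hf : (0 : ℝ) < p.factorial := by exact_mod_cast p.factorial_pos
  have h : Tendsto (fun N : ℕ => (N : ℝ) / (2 * p.factorial)) atTop atTop :=
    tendsto_natCast_atTop_atTop.atTop_div_const (by positivity)
  refine tendsto_atTop_mono' atTop ?_ h
  filter_upwards [eventually_ge_atTop (2 * p.factorial), eventually_ge_atTop 1] with N hN hN1
  have h1 : (1 : ℝ) ≤ N := by exact_mod_cast hN1
  rw [div_le_iff₀' (by positivity)]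
  exact (le_self_pow₀ h1 (by omega)).trans (pow_le_choose hp hN)

lemma tendsto_pow_div_choose {p : ℕ} (hp : 1 ≤ p) :
    Tendsto (fun N : ℕ => (N : ℝ) ^ p / N.choose p) atTop (nhds p.factorial) := by
  have hf : (0 : ℝ) < p.factorial := by exact_mod_cast p.factorial_pos
  have h : Tendsto (fun N : ℕ => (p.factorial : ℝ) * (2 * p.factorial) / N) atTop (nhds 0) :=
    tendsto_const_div_atTop_nhds_zero_nat _
  rw [tendsto_iff_norm_sub_tendsto_zero]
  refine squeeze_zero' (Eventually.of_forall fun _ => norm_nonneg _) ?_ h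
  filter_upwards [eventually_ge_atTop (2 * p.factorial), eventually_ge_atTop 1] with N hN hN1
  have h1 : (0 : ℝ) < N := by exact_mod_cast hN1
  have hpow := pow_le_choose hp hN
  have hC : (0 : ℝ) < N.choose p := by
    have : 0 < (N : ℝ) ^ p := by positivity
    nlinarith
  have hb := choose_bounds (p := p) (N := N)
  have e : (N : ℝ) ^ p / N.choose p - p.factorial
      = -(p.factorial * N.choose p - (N : ℝ) ^ p) / N.choose p := by field_simp; ring
  rw [Real.norm_eq_abs, e, abs_div, abs_neg, abs_of_pos hC, div_le_div_iff₀ hC h1]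
  have e2 : (N : ℝ) ^ p = N ^ (p - 1) * N := by rw [← pow_succ, Nat.sub_add_cancel hp]
  calc _ ≤ p.factorial * (N : ℝ) ^ (p - 1) * N := by gcongr
    _ = p.factorial * (N : ℝ) ^ p := by rw [e2]; ring
    _ ≤ p.factorial * (2 * p.factorial * N.choose p) := by gcongr
    _ = _ := by ring

section
variable {Ω : Type*} [MeasurableSpace Ω] {P : Measure Ω} [IsProbabilityMeasure P] {p : ℕ}

/-- Central limit theorem for the squares of the couplings. -/
lemma tendstoInDistribution_sqSum (hp : 1 ≤ p) {g : ∀ N : ℕ, Finset (Fin N) → Ω → ℝ}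
    (hg : ∀ N, IsCoupling P p N (g N)) :
    TendstoInDistribution (fun (N : ℕ) ω => (√(N.choose p : ℝ))⁻¹ *
        ∑ A : Finset.powersetCard p (Finset.univ : Finset (Fin N)), centredSq (g N A ω))
      atTop id (fun _ => P) (gaussianReal 0 1) where
  forall_aemeasurable N := .const_mul (Finset.aemeasurable_fun_sum _ fun A _ =>
    measurable_centredSq.comp_aemeasurable ((hg N).law A.1 A.2).aemeasurable) _
  tendsto := by
    refine ProbabilityMeasure.tendsto_iff_tendsto_charFun.2 fun t => ?_
    -- Each row has `C` i.i.d. terms, so its characteristic function is a `C`-th power; the i.i.d.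
    -- limit is evaluated along `C → ∞`, with no relation needed between rows.
    have hlim := (tendsto_charFun_inv_sqrt_mul_pow (P := gaussianReal 0 1) (X := centredSq)
      measurable_centredSq.aemeasurable integral_centredSq integral_centredSq_sq t).comp
      (tendsto_choose_atTop hp)
    have hN : ∀ N : ℕ, charFun (P.map fun ω => (√(N.choose p : ℝ))⁻¹ *
        ∑ A : Finset.powersetCard p (Finset.univ : Finset (Fin N)), centredSq (g N A ω)) t
        = charFun ((gaussianReal 0 1).map centredSq) ((√(N.choose p : ℝ))⁻¹ * t)
          ^ (N.choose p) := by
      intro N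
      have hm : ∀ A : Finset.powersetCard p (Finset.univ : Finset (Fin N)),
          AEMeasurable (fun ω => centredSq (g N A ω)) P := fun A =>
        measurable_centredSq.comp_aemeasurable ((hg N).law A.1 A.2).aemeasurable
      have hi : iIndepFun (fun (A : Finset.powersetCard p (Finset.univ : Finset (Fin N))) ω =>
          centredSq (g N A ω)) P := (hg N).indep.comp (fun _ => centredSq)
            fun _ => measurable_centredSq
      rw [charFun_map_mul_comp (Finset.aemeasurable_fun_sum _ fun A _ => hm A),
        iIndepFun.charFun_map_fun_sum_eq_prod hm hi]
      have hl : ∀ A : Finset.powersetCard p (Finset.univ : Finset (Fin N)),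
          P.map (fun ω => centredSq (g N A ω)) = (gaussianReal 0 1).map centredSq := by
        intro A
        rw [← ((hg N).law A.1 A.2).map_eq, AEMeasurable.map_map_of_aemeasurable
          measurable_centredSq.aemeasurable ((hg N).law A.1 A.2).aemeasurable]
        rfl
      simp [hl]
    simp only [ProbabilityMeasure.coe_mk, hN, Measure.map_id]
    rw [charFun_gaussianReal]
    convert! hlim using 2
    simp
    ring_nf

/-! ### Tools for convergence in probability -/

lemma tendstoInMeasure_of_integral_abs_pow {X : ℕ → Ω → ℝ} {k : ℕ}
    (hi : ∀ N, Integrable (fun ω => |X N ω| ^ k) P)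
    (h : Tendsto (fun N => ∫ ω, |X N ω| ^ k ∂P) atTop (nhds 0)) :
    TendstoInMeasure P X atTop 0 := by
  rw [tendstoInMeasure_iff_measureReal_norm]
  intro η hη
  have h2 := h.div_const (η ^ k)
  rw [zero_div] at h2
  refine squeeze_zero (fun _ => measureReal_nonneg) (fun N => ?_) h2
  have h3 := mul_meas_ge_le_integral_of_nonneg (μ := P) (f := fun ω => |X N ω| ^ k)
    (Eventually.of_forall fun ω => by positivity) (hi N) (η ^ k)
  rw [le_div_iff₀ (by positivity), mul_comm]
  refine le_trans (mul_le_mul_of_nonneg_left (measureReal_mono fun ω hω => ?_) (by positivity)) h3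
  simp only [Pi.zero_apply, sub_zero, Real.norm_eq_abs, Set.mem_ofPred_eq] at hω ⊢
  exact pow_le_pow_left₀ hη.le hω k

lemma tendstoInMeasure_add_zero {X Y : ℕ → Ω → ℝ} (hX : TendstoInMeasure P X atTop 0)
    (hY : TendstoInMeasure P Y atTop 0) :
    TendstoInMeasure P (fun N ω => X N ω + Y N ω) atTop 0 := by
  rw [tendstoInMeasure_iff_measureReal_norm] at hX hY ⊢
  intro η hη
  have h := (hX (η / 2) (by positivity)).add (hY (η / 2) (by positivity))
  rw [add_zero] at h
  refine squeeze_zero (fun _ => measureReal_nonneg) (fun N => ?_) h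
  refine (measureReal_mono fun ω hω => ?_).trans (measureReal_union_le _ _)
  simp only [Pi.zero_apply, sub_zero, Set.mem_union, Set.mem_ofPred_eq] at hω ⊢
  by_contra hcon
  push Not at hcon
  linarith [norm_add_le (X N ω) (Y N ω)]

lemma tendstoInMeasure_const {b : ℕ → ℝ} {c : ℝ} (hb : Tendsto b atTop (nhds c)) :
    TendstoInMeasure P (fun N (_ : Ω) => b N) atTop (fun _ => c) :=
  tendstoInMeasure_of_tendsto_ae (fun _ => aestronglyMeasurable_const)
    (Eventually.of_forall fun _ => hb)

/-- Since `a N ≥ 1`, smallness of `a N (Y - 1)` forces `|Y - 1| < 1/2`, where `|log Y| ≤ 2 |Y - 1|`.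
-/
lemma tendstoInMeasure_mul_log {Y : ℕ → Ω → ℝ} {a : ℕ → ℝ} (ha : ∀ᶠ N in atTop, 1 ≤ a N)
    (h : TendstoInMeasure P (fun N ω => a N * (Y N ω - 1)) atTop 0) :
    TendstoInMeasure P (fun N ω => a N * Real.log (Y N ω)) atTop 0 := by
  rw [tendstoInMeasure_iff_measureReal_norm] at h ⊢
  intro η hη
  have h2 := h (min (η / 2) (1 / 2)) (by positivity)
  refine squeeze_zero' (Eventually.of_forall fun _ => measureReal_nonneg) ?_ h2
  filter_upwards [ha] with N hN
  refine measureReal_mono fun ω hω => ?_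
  simp only [Pi.zero_apply, sub_zero, Real.norm_eq_abs, Set.mem_ofPred_eq] at hω ⊢
  by_contra hcon
  push Not at hcon
  have h3 := hcon.trans_le (min_le_left _ _)
  have h4 := hcon.trans_le (min_le_right _ _)
  have ha0 : 0 < a N := by linarith
  rw [abs_mul, abs_of_pos ha0] at h3 h4 hω
  set y := Y N ω
  have h5 : |y - 1| < 1 / 2 := by nlinarith [abs_nonneg (y - 1)]
  have h6 := abs_lt.1 h5
  have hy : 0 < y := by linarith
  have h7 : |Real.log y| ≤ 2 * |y - 1| := by
    rw [abs_le]
    constructor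
    · have h8 := Real.one_sub_inv_le_log_of_pos hy
      have h9 : -(2 * |y - 1|) ≤ 1 - y⁻¹ := by
        have e : 1 - y⁻¹ = (y - 1) / y := by field_simp
        rw [e, le_div_iff₀ hy]
        nlinarith [neg_abs_le (y - 1), abs_nonneg (y - 1)]
      linarith
    · have := Real.log_le_sub_one_of_pos hy
      have := le_abs_self (y - 1)
      have := abs_nonneg (y - 1)
      linarith
  have := mul_le_mul_of_nonneg_left h7 ha0.le
  linarith

end

/-! ### Concentration of the normalised partition function -/

lemma tendsto_pow_mul_exp_neg (k : ℕ) {c : ℝ} (hc : 0 < c) :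
    Tendsto (fun N : ℕ => (N : ℝ) ^ k * Real.exp (-c * N)) atTop (nhds 0) := by
  have h := (tendsto_rpow_mul_exp_neg_mul_atTop_nhds_zero k c hc).comp
    (tendsto_natCast_atTop_atTop (R := ℝ))
  simpa [Function.comp_def] using h

section
variable {Ω : Type*} [MeasurableSpace Ω] {P : Measure Ω} {p : ℕ}

/-- The choice `θ = ε√N/√C` is the optimal Chernoff tilt: the threshold exceeds the tilted mean
`β√N√C` by `ε√N√C`. -/
lemma integral_high_le {N : ℕ} {g : Finset (Fin N) → Ω → ℝ} (hg : IsCoupling P p N g)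
    (hC : N.choose p ≠ 0) {β ε : ℝ} (hβ : 0 ≤ β) (hε : 0 ≤ ε) :
    ∫ ω, avg (fun σ => highWeight p (β * √N / √(N.choose p : ℝ))
        ((β + ε) * √N * √(N.choose p : ℝ)) (fun A => g A ω) σ) ∂P
      ≤ Real.exp (-(ε ^ 2 / 2) * N) := by
  rw [integral_avg fun σ => hg.integrable_highWeight _ _ σ, ← avg_const (N := N)
    (Real.exp (-(ε ^ 2 / 2) * N))]
  refine avg_mono fun σ => ?_
  have hC' : (0 : ℝ) < N.choose p := by exact_mod_cast Nat.pos_of_ne_zero hC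
  refine (hg.integral_highWeight_le (θ := ε * √N / √(N.choose p : ℝ)) (by positivity)
    (by positivity) σ).trans (le_of_eq ?_)
  congr 1
  set C : ℝ := (N.choose p : ℝ)
  have hsN : √(N : ℝ) ^ 2 = N := Real.sq_sqrt (Nat.cast_nonneg N)
  have hsC : √C ^ 2 = C := Real.sq_sqrt hC'.le
  have hsC0 : √C ≠ 0 := (Real.sqrt_pos.2 hC').ne'
  calc _ = (C / √C ^ 2) * √N ^ 2 * (2 * β * ε + ε ^ 2) / 2
        - (√C / √C) * √N ^ 2 * (ε * (β + ε)) := by ring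
    _ = _ := by rw [hsC, hsN, div_self hsC0, div_self hC'.ne']; ring

variable [IsProbabilityMeasure P]

/-- The normalised partition function concentrates around `1` at scale `N ^ (-(p - 2) / 2)`. -/
lemma tendstoInMeasure_avg_weight (hp : 3 ≤ p) {β : ℝ} (hβ : 0 ≤ β) (hβ' : β < betaCrit p)
    {g : ∀ N : ℕ, Finset (Fin N) → Ω → ℝ} (hg : ∀ N : ℕ, IsCoupling P p N (g N)) :
    TendstoInMeasure P (fun (N : ℕ) ω => √(N : ℝ) ^ (p - 2) *
      (avg (fun σ => weight p (β * √N / √(N.choose p : ℝ)) (fun A => g N A ω) σ) - 1))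
      atTop 0 := by
  obtain ⟨ε, hε, K, c, hc, hev⟩ := exists_avg_pairBound_le hp hβ hβ'
  set γ : ℕ → ℝ := fun N => β * √N / √(N.choose p : ℝ) with hγ
  set L : ℕ → ℝ := fun N => (β + ε) * √N * √(N.choose p : ℝ) with hL
  set low : ℕ → Ω → ℝ := fun N ω => avg fun σ => lowWeight p (γ N) (L N) (fun A => g N A ω) σ
    with hlow
  set high : ℕ → Ω → ℝ := fun N ω => avg fun σ => highWeight p (γ N) (L N) (fun A => g N A ω) σ
    with hhigh
  have hC : ∀ᶠ N : ℕ in atTop, N.choose p ≠ 0 := by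
    filter_upwards [eventually_ge_atTop p] with N hN using (Nat.choose_pos hN).ne'
  have hil : ∀ N : ℕ, Integrable (low N) P := fun N =>
    integrable_avg fun σ => (hg N).integrable_lowWeight _ _ σ
  have hih : ∀ N : ℕ, Integrable (high N) P := fun N =>
    integrable_avg fun σ => (hg N).integrable_highWeight _ _ σ
  have hil2 : ∀ N : ℕ, Integrable (fun ω => low N ω ^ 2) P := fun N =>
    (hg N).integrable_avg_lowWeight_sq _ _
  have hsum : ∀ (N : ℕ) (ω : Ω), low N ω + high N ω = avg fun σ => weight p (γ N) (fun A => g N A ω) σ := by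
    intro N ω
    rw [hlow, hhigh, ← avg_add]
    simp only [low_add_high]
  have hhigh0 : ∀ N ω, 0 ≤ high N ω := fun N ω =>
    mul_nonneg (by positivity) (Finset.sum_nonneg fun σ _ => highWeight_nonneg _ _ _ _)
  have hint : ∀ N : ℕ, ∫ ω, low N ω ∂P = 1 - ∫ ω, high N ω ∂P := by
    intro N
    rw [eq_sub_iff_add_eq, ← integral_add (hil N) (hih N)]
    simp only [hsum]
    rw [integral_avg fun σ => (hg N).integrable_weight _ σ]
    simp only [(hg N).integral_weight, avg_const]
  have hhighle : ∀ᶠ N : ℕ in atTop, ∫ ω, high N ω ∂P ≤ Real.exp (-(ε ^ 2 / 2) * N) := by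
    filter_upwards [hC] with N hN using integral_high_le (hg N) hN hβ hε.le
  have ha : ∀ N : ℕ, 0 ≤ √(N : ℝ) ^ (p - 2) := fun N => by positivity
  have hasq : ∀ N : ℕ, (√(N : ℝ) ^ (p - 2)) ^ 2 = (N : ℝ) ^ (p - 2) := fun N => by
    rw [← pow_mul, mul_comm, pow_mul, Real.sq_sqrt (Nat.cast_nonneg N)]
  have hsplit : (fun (N : ℕ) ω => √(N : ℝ) ^ (p - 2) *
      (avg (fun σ => weight p (γ N) (fun A => g N A ω) σ) - 1))
      = fun (N : ℕ) ω => √(N : ℝ) ^ (p - 2) * (low N ω - 1) + √(N : ℝ) ^ (p - 2) * high N ω := by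
    ext N ω
    rw [← hsum]; ring
  rw [hsplit]
  have he1 := tendsto_pow_mul_exp_neg (p - 2) (c := ε ^ 2 / 2) (by positivity)
  have he2 := tendsto_pow_mul_exp_neg (p - 2) hc
  have he3 := tendsto_pow_mul_exp_neg (p - 2 + 1) hc
  -- The cubic error survives the scaling: `N^(p-2) · N^(3-3p/2) = N^(-(p-2)/2)`.
  have he4 : Tendsto (fun N : ℕ => (N : ℝ) ^ (p - 2) * ((N : ℝ) ^ 3 / √(N : ℝ) ^ (3 * p)))
      atTop (nhds 0) := by
    have h : Tendsto (fun N : ℕ => (√(N : ℝ) ^ (p - 2))⁻¹) atTop (nhds 0) :=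
      ((tendsto_pow_atTop (by omega)).comp
        (Real.tendsto_sqrt_atTop.comp tendsto_natCast_atTop_atTop)).inv_tendsto_atTop
    refine h.congr' ?_
    filter_upwards [eventually_ge_atTop 1] with N hN
    have hN' : (0 : ℝ) < N := by exact_mod_cast hN
    have hs : (0 : ℝ) < √(N : ℝ) := Real.sqrt_pos.2 hN'
    have e1 : (N : ℝ) ^ 3 = √(N : ℝ) ^ 6 := by
      rw [show (6 : ℕ) = 2 * 3 by norm_num, pow_mul, Real.sq_sqrt hN'.le]
    rw [← hasq, e1, ← mul_div_assoc, eq_div_iff (by positivity), inv_mul_eq_iff_eq_mul₀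
      (by positivity), ← pow_mul, ← pow_add, ← pow_add]
    congr 1
    omega
  refine tendstoInMeasure_add_zero ?_ ?_
  · refine tendstoInMeasure_of_integral_abs_pow (k := 2) (fun N => ?_) ?_
    · simp only [sq_abs, mul_pow, sub_sq, one_pow, mul_one]
      exact (((hil2 N).sub ((hil N).const_mul 2)).add (integrable_const 1)).const_mul _
    -- The low part has mean `1 - E[high]`, so centring it at `1` costs only `2 E[high]` beyond the
    -- excess of the second moment over `1`.
    · have hval : ∀ N : ℕ, ∫ ω, |√(N : ℝ) ^ (p - 2) * (low N ω - 1)| ^ 2 ∂P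
          = (N : ℝ) ^ (p - 2) * (∫ ω, low N ω ^ 2 ∂P - 1 + 2 * ∫ ω, high N ω ∂P) := by
        intro N
        simp only [sq_abs, mul_pow, hasq, sub_sq, one_pow, mul_one]
        rw [integral_const_mul, integral_add (f := fun ω => low N ω ^ 2 - 2 * low N ω)
          ((hil2 N).sub ((hil N).const_mul 2)) (integrable_const 1),
          integral_sub (hil2 N) ((hil N).const_mul 2), integral_const_mul, hint, integral_const,
          probReal_univ, one_smul]
        ring
      have hlim : Tendsto (fun N : ℕ => K * ((N : ℝ) ^ (p - 2) * ((N : ℝ) ^ 3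
            / √(N : ℝ) ^ (3 * p))) + K * (2 * ((N : ℝ) ^ (p - 2 + 1) * Real.exp (-c * N))
            + (N : ℝ) ^ (p - 2) * Real.exp (-c * N))
            + 2 * ((N : ℝ) ^ (p - 2) * Real.exp (-(ε ^ 2 / 2) * N))) atTop (nhds 0) := by
        have := ((he4.const_mul K).add (((he3.const_mul 2).add he2).const_mul K)).add
          (he1.const_mul 2)
        simpa using this
      refine squeeze_zero' (Eventually.of_forall fun N => integral_nonneg fun ω => by
        positivity) ?_ hlim
      filter_upwards [hev, hhighle] with N ⟨l, hl, hle⟩ hh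
      rw [hval]
      have h2 := ((hg N).integral_avg_lowWeight_sq_le (γ := γ N) (L := L N) hl).trans hle
      have h3 : ∫ ω, low N ω ^ 2 ∂P - 1 + 2 * ∫ ω, high N ω ∂P
          ≤ K * ((N : ℝ) ^ 3 / √(N : ℝ) ^ (3 * p)) + K * ((2 * N + 1) * Real.exp (-c * N))
            + 2 * Real.exp (-(ε ^ 2 / 2) * N) := by linarith
      refine (mul_le_mul_of_nonneg_left h3 (by positivity)).trans (le_of_eq ?_)
      ring
  · refine tendstoInMeasure_of_integral_abs_pow (k := 1) (fun N => ?_) ?_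
    · simp only [pow_one]
      exact ((hih N).const_mul _).abs
    · refine squeeze_zero' (Eventually.of_forall fun N => integral_nonneg fun ω => by
        positivity) ?_ he1
      filter_upwards [hhighle, eventually_ge_atTop 1] with N hh hN
      have hN' : (1 : ℝ) ≤ √(N : ℝ) := Real.one_le_sqrt.2 (by exact_mod_cast hN)
      have h1 : ∀ ω, |√(N : ℝ) ^ (p - 2) * high N ω| ^ 1 = √(N : ℝ) ^ (p - 2) * high N ω :=
        fun ω => by rw [pow_one, abs_of_nonneg (mul_nonneg (ha N) (hhigh0 N ω))]
      simp only [h1]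
      rw [integral_const_mul]
      have h2 : √(N : ℝ) ^ (p - 2) ≤ (N : ℝ) ^ (p - 2) := by
        rw [← hasq]
        exact le_self_pow₀ (one_le_pow₀ hN') (by norm_num)
      exact mul_le_mul h2 hh (integral_nonneg fun ω => hhigh0 N ω) (by positivity)

end

/-! ### Decomposition of the free energy -/

/-- The logarithm of the mean weight is negligible at scale `N ^ (-(p - 2) / 2)`. -/
lemma tendsto_log_meanWeight {p : ℕ} (hp : 3 ≤ p) (β : ℝ) :
    Tendsto (fun N : ℕ => √(N : ℝ) ^ (p - 2)
      * Real.log (meanWeight (N.choose p) (β * √N / √(N.choose p : ℝ)))) atTop (nhds 0) := by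
  have hf : (0 : ℝ) < p.factorial := by exact_mod_cast p.factorial_pos
  have h : Tendsto (fun N : ℕ => 2 * β ^ 4 * p.factorial * (√(N : ℝ) ^ (p - 2))⁻¹)
      atTop (nhds 0) := by
    have := ((tendsto_pow_atTop (show p - 2 ≠ 0 by omega)).comp
        (Real.tendsto_sqrt_atTop.comp
          (tendsto_natCast_atTop_atTop (R := ℝ)))).inv_tendsto_atTop.const_mul
          (2 * β ^ 4 * p.factorial)
    simpa using this
  refine squeeze_zero_norm' ?_ h
  filter_upwards [eventually_ge_atTop (2 * p.factorial), eventually_ge_atTop 1] with N hN hN1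
  have hN' : (0 : ℝ) < N := by exact_mod_cast hN1
  have hpow := pow_le_choose (by omega) hN
  have hC : (0 : ℝ) < N.choose p := by
    have : 0 < (N : ℝ) ^ p := by positivity
    nlinarith
  rw [meanWeight_eq_exp, Real.log_exp]
  set C : ℝ := (N.choose p : ℝ)
  have hsN : √(N : ℝ) ^ 2 = N := Real.sq_sqrt hN'.le
  have hsC : √C ^ 2 = C := Real.sq_sqrt hC.le
  have hs : 0 < √(N : ℝ) := Real.sqrt_pos.2 hN'
  have hγ : (β * √N / √C) ^ 2 = β ^ 2 * N / C := by rw [div_pow, mul_pow, hsN, hsC]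
  rw [hγ]
  set q := β ^ 2 * N / C with hq
  have hq0 : 0 ≤ q := by positivity
  -- The first-order terms cancel, leaving `C q² = β⁴ N²/C`, of order `N^(2-p)`.
  have hb : |q / (2 * (1 + q)) - Real.log (1 + q) / 2| ≤ q ^ 2 := by
    have h1 := Real.log_le_sub_one_of_pos (show 0 < 1 + q by linarith)
    have h2 := Real.one_sub_inv_le_log_of_pos (show 0 < 1 + q by linarith)
    have e1 : q / (2 * (1 + q)) = (1 - (1 + q)⁻¹) / 2 := by field_simp; ring
    have e2 : q - q ^ 2 ≤ 1 - (1 + q)⁻¹ := by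
      have : 1 - (1 + q)⁻¹ = q / (1 + q) := by field_simp; ring
      rw [this, le_div_iff₀ (by linarith)]
      nlinarith [pow_nonneg hq0 3]
    rw [e1, abs_le]
    constructor <;> nlinarith
  rw [Real.norm_eq_abs, abs_mul, abs_mul, abs_of_pos hC, abs_of_pos (by positivity : 0 < √(N : ℝ) ^ (p - 2))]
  have hsq : (√(N : ℝ) ^ (p - 2)) ^ 2 * (N : ℝ) ^ 2 = (N : ℝ) ^ p := by
    rw [← pow_mul, mul_comm (p - 2), pow_mul, hsN, ← pow_add]
    congr 1
    omega
  rw [← div_eq_mul_inv, le_div_iff₀ (by positivity)]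
  calc _ ≤ √(N : ℝ) ^ (p - 2) * (C * q ^ 2) * √(N : ℝ) ^ (p - 2) := by gcongr
    _ = β ^ 4 * ((√(N : ℝ) ^ (p - 2)) ^ 2 * (N : ℝ) ^ 2) / C := by rw [hq]; field_simp
    _ ≤ _ := by
      rw [hsq, div_le_iff₀ hC]
      calc _ ≤ β ^ 4 * (2 * p.factorial * C) := by gcongr
        _ = _ := by ring

lemma partitionFn_eq (p N : ℕ) (β : ℝ) (J : Finset ℕ → ℝ) :
    partitionFn p N β J
      = avg (fun σ => weight p (β * √N / √(N.choose p : ℝ))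
          (fun A : Finset (Fin N) => J (A.map Fin.valEmbedding)) σ)
        * meanWeight (N.choose p) (β * √N / √(N.choose p : ℝ))
        * Real.exp ((β * √N / √(N.choose p : ℝ)) ^ 2 / 2
          * sqSum p (fun A : Finset (Fin N) => J (A.map Fin.valEmbedding))) := by
  have hM := meanWeight_pos (N.choose p) (β * √N / √(N.choose p : ℝ))
  rw [partitionFn, avg, mul_assoc, mul_assoc, Finset.sum_mul]
  congr 1
  refine Finset.sum_congr rfl fun σ _ => ?_
  rw [weight, div_mul_eq_mul_div, mul_left_comm, mul_div_cancel_left₀ _ hM.ne', ← Real.exp_add]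
  congr 1
  rw [hamiltonian, field, energy]
  ring

lemma avg_weight_pos {p N : ℕ} (γ : ℝ) (x : Finset (Fin N) → ℝ) :
    0 < avg (fun σ => weight p γ x σ) :=
  mul_pos (by positivity) (Finset.sum_pos (fun σ _ => weight_pos _ _ _) Finset.univ_nonempty)

lemma sqSum_eq {p N : ℕ} (x : Finset (Fin N) → ℝ) :
    sqSum p x = N.choose p
      + √2 * ∑ A : Finset.powersetCard p (Finset.univ : Finset (Fin N)), centredSq (x A) := by
  rw [Finset.sum_coe_sort _ fun A => centredSq (x A)]
  simp only [centredSq]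
  rw [← Finset.sum_div, mul_div_cancel₀ _ (by positivity), Finset.sum_sub_distrib, sqSum]
  simp

/-- The mean of `∑ J_A²` produces exactly `β²/2`, which cancels; what remains is two negligible
logarithms and the normalised sum of squares times a convergent deterministic factor. -/
lemma scaled_freeEnergy_eq {p N : ℕ} (hp : 2 ≤ p) (hN : p ≤ N) (β : ℝ) (J : Finset ℕ → ℝ) :
    (N : ℝ) ^ ((p : ℝ) / 2) * (freeEnergy p N β J - β ^ 2 / 2)
      = √(N : ℝ) ^ (p - 2) * Real.log (avg (fun σ => weight p (β * √N / √(N.choose p : ℝ))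
          (fun A : Finset (Fin N) => J (A.map Fin.valEmbedding)) σ))
        + √(N : ℝ) ^ (p - 2)
          * Real.log (meanWeight (N.choose p) (β * √N / √(N.choose p : ℝ)))
        + ((√(N.choose p : ℝ))⁻¹ * ∑ A : Finset.powersetCard p (Finset.univ : Finset (Fin N)),
            centredSq (J ((A : Finset (Fin N)).map Fin.valEmbedding)))
          * (β ^ 2 * √2 / 2 * √((N : ℝ) ^ p / N.choose p)) := by
  have hN' : (0 : ℝ) < N := by exact_mod_cast (by omega : 0 < N)
  have hC : (0 : ℝ) < N.choose p := by exact_mod_cast Nat.choose_pos hN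
  rw [freeEnergy, partitionFn_eq, Real.log_mul (mul_pos (avg_weight_pos _ _)
    (meanWeight_pos _ _)).ne' (Real.exp_pos _).ne', Real.log_mul (avg_weight_pos _ _).ne'
    (meanWeight_pos _ _).ne', Real.log_exp, sqSum_eq]
  set C : ℝ := (N.choose p : ℝ)
  have hsN : √(N : ℝ) ^ 2 = N := Real.sq_sqrt hN'.le
  have hsC : √C ^ 2 = C := Real.sq_sqrt hC.le
  have hs : 0 < √C := Real.sqrt_pos.2 hC
  have hγ : (β * √N / √C) ^ 2 = β ^ 2 * N / C := by rw [div_pow, mul_pow, hsN, hsC]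
  have hr : (N : ℝ) ^ ((p : ℝ) / 2) = √(N : ℝ) ^ (p - 2) * N := by
    rw [Real.rpow_div_two_eq_sqrt _ hN'.le, Real.rpow_natCast, ← hsN, Real.sqrt_sq (by positivity),
      ← pow_add]
    congr 1
    omega
  have hr2 : √((N : ℝ) ^ p / C) = √(N : ℝ) ^ (p - 2) * N / √C := by
    rw [Real.sqrt_div (by positivity), ← hr, Real.rpow_div_two_eq_sqrt _ hN'.le,
      Real.rpow_natCast]
    congr 1
    have h : (N : ℝ) ^ p = (√(N : ℝ) ^ p) ^ 2 := by rw [← pow_mul, mul_comm, pow_mul, hsN]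
    rw [h, Real.sqrt_sq (by positivity)]
  rw [hγ, hr, hr2]
  have hC2 : C = √C * √C := (Real.mul_self_sqrt hC.le).symm
  set X := ∑ A : Finset.powersetCard p (Finset.univ : Finset (Fin N)),
            centredSq (J ((A : Finset (Fin N)).map Fin.valEmbedding))
  have e : β ^ 2 * N / C / 2 * (C + √2 * X) = β ^ 2 * N / 2 + β ^ 2 * N * √2 * X / (2 * (√C * √C)) := by
    rw [← hC2]; field_simp
  rw [e]
  field_simp
  ring

end

end PSpin

/-- Central limit theorem for the free energy of the `p`-spin model. -/
theorem theorem1p1 {Ω : Type*} [MeasurableSpace Ω] (P : Measure Ω) [IsProbabilityMeasure P]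
    (p : ℕ) (hp : 3 ≤ p) (J : Finset ℕ → Ω → ℝ)
    (hJ_law : ∀ A : Finset ℕ, A.card = p → HasLaw (J A) (gaussianReal 0 1) P)
    (hJ_indep : iIndepFun (fun A : {A : Finset ℕ // A.card = p} => J A) P)
    (β : ℝ) (hβ_nonneg : 0 ≤ β) (hβ : β < PSpin.betaCrit p) :
    TendstoInDistribution
      (fun (N : ℕ) (ω : Ω) =>
        (N : ℝ) ^ ((p : ℝ) / 2) * (PSpin.freeEnergy p N β (fun A => J A ω) - β ^ 2 / 2))
      atTop id (fun _ => P)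
      (gaussianReal 0 (Real.toNNReal (β ^ 4 * (Nat.factorial p : ℝ) / 2))) := by
  set g : ∀ N : ℕ, Finset (Fin N) → Ω → ℝ := fun N A ω => J (A.map Fin.valEmbedding) ω with hgdef
  have hg : ∀ N : ℕ, PSpin.IsCoupling P p N (g N) := by
    intro N
    have hcard : ∀ A ∈ Finset.powersetCard p (Finset.univ : Finset (Fin N)),
        (A.map Fin.valEmbedding).card = p := fun A hA => by
      rw [Finset.card_map, (Finset.mem_powersetCard.1 hA).2]
    refine ⟨fun A hA => hJ_law _ (hcard A hA), ?_⟩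
    -- Independence passes to the system of size `N` because distinct subsets of `Fin N` have
    -- distinct images in `ℕ`.
    refine hJ_indep.precomp (g := fun A : Finset.powersetCard p (Finset.univ : Finset (Fin N)) =>
      (⟨A.1.map Fin.valEmbedding, hcard A.1 A.2⟩ : {A : Finset ℕ // A.card = p})) ?_
    intro A B hAB
    exact Subtype.ext (Finset.map_injective _ (congrArg Subtype.val hAB))
  have hJm : ∀ N : ℕ, AEMeasurable (fun ω => (N : ℝ) ^ ((p : ℝ) / 2) *
      (PSpin.freeEnergy p N β (fun A => J A ω) - β ^ 2 / 2)) P := by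
    intro N
    have h1 : AEMeasurable (fun ω => PSpin.partitionFn p N β (fun A => J A ω)) P := by
      simp only [PSpin.partitionFn_eq]
      refine AEMeasurable.mul (AEMeasurable.mul_const ?_ _) ?_
      · exact (Finset.aemeasurable_fun_sum _ fun σ _ =>
          (hg N).aemeasurable_weight _ σ).const_mul _
      · exact Real.measurable_exp.comp_aemeasurable ((hg N).aemeasurable_sqSum.const_mul _)
    have h2 := Real.measurable_log.comp_aemeasurable h1
    exact ((h2.const_mul _).sub_const _).const_mul _
  have hlog := PSpin.tendstoInMeasure_mul_log (by
      filter_upwards [eventually_ge_atTop 1] with N hN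
      exact one_le_pow₀ (Real.one_le_sqrt.2 (by exact_mod_cast hN)))
    (PSpin.tendstoInMeasure_avg_weight hp hβ_nonneg hβ hg)
  have hrem := PSpin.tendstoInMeasure_add_zero hlog
    (PSpin.tendstoInMeasure_const (P := P) (PSpin.tendsto_log_meanWeight hp β))
  set b : ℕ → ℝ := fun N => β ^ 2 * √2 / 2 * √((N : ℝ) ^ p / N.choose p) with hb
  have hblim : Tendsto b atTop (nhds (β ^ 2 * √2 / 2 * √(p.factorial : ℝ))) :=
    ((PSpin.tendsto_pow_div_choose (by omega)).sqrt).const_mul _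
  -- Slutsky's theorem, first for the product with the deterministic factor `b N`, then for the
  -- remainder tending to zero in probability.
  have hprod := (PSpin.tendstoInDistribution_sqSum (by omega)
    hg).continuous_comp_prodMk_of_tendstoInMeasure_const (g := fun z : ℝ × ℝ => z.1 * z.2)
    (by fun_prop) (PSpin.tendstoInMeasure_const (P := P) hblim) (fun N => aemeasurable_const)
  have hfin := tendstoInDistribution_of_tendstoInMeasure_sub
    (fun (N : ℕ) (ω : Ω) =>
        (N : ℝ) ^ ((p : ℝ) / 2) * (PSpin.freeEnergy p N β (fun A => J A ω) - β ^ 2 / 2)) _ hprod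
    (hrem.congr' (by
      filter_upwards [eventually_ge_atTop p] with N hN
      refine Eventually.of_forall fun ω => ?_
      simp only [Pi.sub_apply]
      rw [PSpin.scaled_freeEnergy_eq (by omega) hN]
      ring) (Eventually.of_forall fun ω => rfl)) hJm
  refine ⟨hJm, aemeasurable_id, ?_⟩
  convert! hfin.tendsto using 3
  have hm := gaussianReal_map_mul_const (μ := 0) (v := 1) (β ^ 2 * √2 / 2 * √(p.factorial : ℝ))
  -- The limiting variance is the square of `lim b N = β² √2/2 · √(p!)`.
  have hv : NNReal.mk ((β ^ 2 * √2 / 2 * √(p.factorial : ℝ)) ^ 2) (sq_nonneg _) * 1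
      = Real.toNNReal (β ^ 4 * (Nat.factorial p : ℝ) / 2) := by
    refine NNReal.eq ?_
    rw [Real.coe_toNNReal _ (by positivity), mul_one, NNReal.coe_mk, mul_pow, div_pow, mul_pow,
      Real.sq_sqrt (by norm_num), Real.sq_sqrt (by positivity)]
    ring
  rw [mul_zero, hv] at hm
  refine congrArg nhds (Subtype.ext ?_)
  simp only [Measure.map_id]
  exact hm.symm
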